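/- Let $\mathbb{T}^3=(\mathbb{R}/\mathbb{Z})^3$, let $\nu>0$ and $\rho_{\mathrm{ion}}>0$, and let $f:\mathbb{T}^3\times\mathbb{R}^3\to\mathbb{R}$ and $E,B:\mathbb{T}^3\to\mathbb{R}^3$ satisfy the following. (a) $f(x,v)>0$ for all $x,v$; $f(x,\cdot)$ is $C^3$ on $\mathbb{R}^3$ for every $x$; $f(\cdot,v)$ is $C^2$ on $\mathbb{T}^3$ for every $v$; $B$ is $C^2$ on $\mathbb{T}^3$. (b) (Uniform Schwartz-class velocity decay) For every $n\in\{0,1,2,3\}$ and $N\in\mathbb{N}$ there is $C$ with $(1+|v|)^N\,\|D_v^n f(x,v)\|\le C$ for all $x\in\mathbb{T}^3$, $v\in\mathbb{R}^3$. (c) (Polynomial score bound) There are $C\in\mathbb{R}$ and $K\in\mathbb{N}$ with $|\partial_{v_i}f(x,v)|\le C(1+|v|)^K f(x,v)$ for all $x$, $v$ and $i=1,2,3$. (d) $(f,E,B)$ is a steady state of the Vlasov–Maxwell–Landau system with Coulomb collisions: for all $x\in\mathbb{T}^3$ and $v\in\mathbb{R}^3$, $$v\cdot\nabla_x f+(E+v\times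 B)\cdot\nabla_v f=\nu\,Q(f,f),\qquad \nabla\times B=\int_{\mathbb{R}^3}v f\,dv,\qquad \nabla\cdot E=\int_{\mathbb{R}^3}f\,dv-\rho_{\mathrm{ion}},\qquad \nabla\cdot B=0,$$ where $Q(f,f)$ is the Landau collision operator, acting at each fixed $x$ on $g=f(x,\cdot)$ by $$Q(g,g)(v)=\nabla_v\cdot\int_{\mathbb{R}^3}A(v-w)\bigl(g(w)\nabla g(v)-g(v)\nabla g(w)\bigr)\,dw,\qquad A(z)=\Psi(|z|)\bigl(|z|^2 I-z\otimes z\bigr),$$ with the Coulomb kernel $\Psi(r)=r^{-3}$. Then there are $T>0$ and $B_0\in\mathbb{R}^3$ such that for all $x\in\mathbb{T}^3$ and $v\in\mathbb{R}^3$ $$f(x,v)=\frac{\rho_{\mathrm{ion}}}{(2\pi T)^{3/2}}\exp\Bigl(-\frac{|v|^2}{2T}\Bigr),\qquad E(x)=0,\qquad B(x)=B_0 .$$ -/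

import Mathlib

open MeasureTheory

noncomputable section

/-- The flat torus `(ℝ/ℤ)³`. -/
abbrev Torus3 : Type := UnitAddTorus (Fin 3)

/-- Three-dimensional space with its Euclidean norm: velocities and field values. -/
abbrev Vec3 : Type := EuclideanSpace ℝ (Fin 3)

/-- The lift of a function on the torus to a `ℤ³`-periodic function on `ℝ³`. -/
def periodicLift (g : Torus3 → ℝ) : (Fin 3 → ℝ) → ℝ :=
  fun y => g (fun i => (y i : UnitAddCircle))

/-- The partial derivative `∂g/∂xᵢ` of a function on the torus. -/
def torusPartial (i : Fin 3) (g : Torus3 → ℝ) (x : Torus3) : ℝ :=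
  deriv (fun t : ℝ => g (x + Pi.single i (t : UnitAddCircle))) 0

/-- The divergence of a vector field on the torus. -/
def torusDiv (F : Torus3 → Vec3) (x : Torus3) : ℝ :=
  ∑ i, torusPartial i (fun y => F y i) x

/-- The curl of a vector field on the torus. -/
def torusCurl (F : Torus3 → Vec3) (x : Torus3) : Vec3 :=
  !₂[torusPartial 1 (fun y => F y 2) x - torusPartial 2 (fun y => F y 1) x,
     torusPartial 2 (fun y => F y 0) x - torusPartial 0 (fun y => F y 2) x,
     torusPartial 0 (fun y => F y 1) x - torusPartial 1 (fun y => F y 0) x]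

/-- The partial derivative `∂g/∂vᵢ` of a function of the velocity. -/
def velPartial (i : Fin 3) (g : Vec3 → ℝ) (v : Vec3) : ℝ :=
  fderiv ℝ g v (EuclideanSpace.single i 1)

/-- The cross product `v × w`. -/
def cross (v w : Vec3) : Vec3 :=
  WithLp.toLp 2 (crossProduct (WithLp.ofLp v) (WithLp.ofLp w))

/-- The Coulomb kernel `Ψ(r) = r⁻³`. -/
def coulombKernel (r : ℝ) : ℝ := (r ^ 3)⁻¹

/-- The Landau matrix `A(z) = Ψ(|z|) (|z|² I - z ⊗ z)`. -/
def landauMatrix (Ψ : ℝ → ℝ) (z : Vec3) : Matrix (Fin 3) (Fin 3) ℝ :=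
  Matrix.of fun i j => Ψ ‖z‖ * ((if i = j then ‖z‖ ^ 2 else 0) - z i * z j)

/-- The `i`-th component of the collisional flux
`∫ A(v - w) (g(w) ∇g(v) - g(v) ∇g(w)) dw`. -/
def landauFlux (Ψ : ℝ → ℝ) (g : Vec3 → ℝ) (i : Fin 3) (v : Vec3) : ℝ :=
  ∫ w, ∑ j, landauMatrix Ψ (v - w) i j * (g w * velPartial j g v - g v * velPartial j g w)

/-- The Landau collision operator `Q(g, g)(v) = ∇ᵥ · ∫ A(v - w) (g(w) ∇g(v) - g(v) ∇g(w)) dw`. -/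
def landauOperator (Ψ : ℝ → ℝ) (g : Vec3 → ℝ) (v : Vec3) : ℝ :=
  ∑ i, velPartial i (landauFlux Ψ g i) v

/-- Schwartz-class velocity decay, uniformly in `x`, of a function that is `C³` in the velocity:
`f` and all its velocity derivatives of order at most three decay
faster than any power of `|v|`. -/
def UniformSchwartzDecay (f : Torus3 → Vec3 → ℝ) : Prop :=
  ∀ n ≤ 3, ∀ N : ℕ, ∃ C : ℝ, ∀ x v,
    (1 + ‖v‖) ^ N * ‖iteratedFDeriv ℝ n (f x) v‖ ≤ C

/-- The centred Maxwellian `ρ (2πT)^{-3/2} exp(-|v|²/2T)`. -/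
def equilibriumMaxwellian (ρ T : ℝ) (v : Vec3) : ℝ :=
  ρ / (2 * Real.pi * T) ^ (3 / 2 : ℝ) * Real.exp (-‖v‖ ^ 2 / (2 * T))

end

noncomputable section

open Filter Topology

/-! ### Partial derivatives in the velocity -/

/-! The engine is the H-theorem. Test the Vlasov equation with `log f`. The transport term is the
`x`-divergence of `v (f log f - f)` and integrates to zero over the torus. The Lorentz force is
divergence free in `v` and contributes nothing. The collision term equals minus half the integral of
`A(v - w)` on score differences, weighted by `f(v) f(w)`, hence is nonpositive at each `x`. So the
dissipation vanishes for almost every `x`, and for all `x` by continuity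
(`IsSteadyState.score_collinear`). Since `A(z)` only annihilates multiples of `z`, the score is
affine with scalar linear part, and `log f = c + a · v + b |v|² / 2` with `b < 0`.

The collision term now vanishes, and the Vlasov equation becomes a cubic polynomial identity in `v`
(`vlasov_polynomial`). It makes `b` constant and `a` a Killing field, constant by periodicity. The
current is a curl, so it has mean zero, which forces `a = 0`; then the current is zero and `B` is
both curl and divergence free, hence harmonic and constant. What remains is `∇c = -b E` with Gauss's
law, a Poisson–Boltzmann equation whose only solution, by the maximum principle, has density `ρ_ion`
(`density_eq_ion`). So `c` is constant and `E = 0`.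

The analytic difficulty is uniformity in `x`: no regularity of `E`, no joint regularity of `f` and
no velocity decay of `∇ₓ f` are assumed. Decay bounds therefore carry explicit constants `D` shared
by all `x`, boundedness of `E` is extracted from the equation (`bounded_E`), and decay of the
transport term follows. -/

lemma abs_velPartial_le (i : Fin 3) (g : Vec3 → ℝ) (v : Vec3) :
    |velPartial i g v| ≤ ‖fderiv ℝ g v‖ := by
  have h := (fderiv ℝ g v).le_opNorm (EuclideanSpace.single i (1 : ℝ))
  simpa [velPartial] using h

lemma abs_coord_le (v : Vec3) (i : Fin 3) : |v i| ≤ ‖v‖ := by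
  simpa using PiLp.norm_apply_le v i

lemma vec_eq_sum (u : Vec3) : u = ∑ i, u i • EuclideanSpace.single i (1 : ℝ) := by
  ext j
  simp [Finset.sum_apply, Pi.single_apply]

lemma fderiv_eq_sum_velPartial (g : Vec3 → ℝ) (v u : Vec3) :
    fderiv ℝ g v u = ∑ i, u i * velPartial i g v := by
  conv_lhs => rw [vec_eq_sum u]
  simp [velPartial]

lemma norm_fderiv_le_sum (g : Vec3 → ℝ) (v : Vec3) :
    ‖fderiv ℝ g v‖ ≤ ∑ i, |velPartial i g v| := by
  refine ContinuousLinearMap.opNorm_le_bound _ (Finset.sum_nonneg fun i _ => abs_nonneg _) ?_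
  intro u
  rw [fderiv_eq_sum_velPartial, Finset.sum_mul]
  refine (Finset.abs_sum_le_sum_abs _ _).trans (Finset.sum_le_sum fun i _ => ?_)
  rw [abs_mul, mul_comm]
  exact mul_le_mul_of_nonneg_left (abs_coord_le u i) (abs_nonneg _)

lemma measurable_velPartial (i : Fin 3) (g : Vec3 → ℝ) : Measurable (velPartial i g) :=
  measurable_fderiv_apply_const ℝ g _

lemma ContDiff.velPartial {n m : WithTop ℕ∞} {g : Vec3 → ℝ} (hg : ContDiff ℝ n g)
    (hmn : m + 1 ≤ n) (i : Fin 3) : ContDiff ℝ m (velPartial i g) :=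
  (hg.fderiv_right hmn).clm_apply contDiff_const

lemma velPartial_mul (i : Fin 3) {g h : Vec3 → ℝ} {v : Vec3} (hg : DifferentiableAt ℝ g v)
    (hh : DifferentiableAt ℝ h v) :
    velPartial i (fun v => g v * h v) v = g v * velPartial i h v + h v * velPartial i g v := by
  simp [velPartial, fderiv_fun_mul hg hh]

lemma velPartial_sub (i : Fin 3) {g h : Vec3 → ℝ} {v : Vec3} (hg : DifferentiableAt ℝ g v)
    (hh : DifferentiableAt ℝ h v) :
    velPartial i (fun v => g v - h v) v = velPartial i g v - velPartial i h v := by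
  simp [velPartial, fderiv_fun_sub hg hh]

lemma velPartial_sum (i : Fin 3) {g : Fin 3 → Vec3 → ℝ} {v : Vec3}
    (hg : ∀ j, DifferentiableAt ℝ (g j) v) :
    velPartial i (fun v => ∑ j, g j v) v = ∑ j, velPartial i (g j) v := by
  simp [velPartial, fderiv_fun_sum fun j (_ : j ∈ Finset.univ) => hg j]

lemma velPartial_log (i : Fin 3) {g : Vec3 → ℝ} {v : Vec3} (hg : DifferentiableAt ℝ g v)
    (h0 : g v ≠ 0) :
    velPartial i (fun v => Real.log (g v)) v = velPartial i g v / g v := by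
  simp [velPartial, fderiv.log hg h0, div_eq_inv_mul]

/-! ### Rapid decay and polynomial growth -/

/-- `h` decays faster than every power of the velocity, with constants `D`. -/
def RapidDecay (D : ℕ → ℝ) (h : Vec3 → ℝ) : Prop :=
  ∀ N v, (1 + ‖v‖) ^ N * |h v| ≤ D N

/-- `p` grows at most like `C (1 + |v|) ^ m`. -/
def PolyGrowth (C : ℝ) (m : ℕ) (p : Vec3 → ℝ) : Prop :=
  ∀ v, |p v| ≤ C * (1 + ‖v‖) ^ m

lemma one_add_norm_pos (v : Vec3) : 0 < 1 + ‖v‖ := by positivity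

lemma RapidDecay.nonneg {D : ℕ → ℝ} {h : Vec3 → ℝ} (hh : RapidDecay D h) (N : ℕ) : 0 ≤ D N :=
  le_trans (by positivity) (hh N 0)

lemma PolyGrowth.nonneg {C : ℝ} {m : ℕ} {p : Vec3 → ℝ} (hp : PolyGrowth C m p) : 0 ≤ C := by
  simpa using (abs_nonneg _).trans (hp 0)

lemma RapidDecay.le_inv {D : ℕ → ℝ} {h : Vec3 → ℝ} (hh : RapidDecay D h) (N : ℕ) (v : Vec3) :
    |h v| ≤ D N * ((1 + ‖v‖) ^ N)⁻¹ := by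
  rw [← div_eq_mul_inv, le_div_iff₀ (by positivity), mul_comm]
  exact hh N v

lemma RapidDecay.mul_poly {D : ℕ → ℝ} {h p : Vec3 → ℝ} {C : ℝ} {m : ℕ} (hh : RapidDecay D h)
    (hp : PolyGrowth C m p) : RapidDecay (fun N => C * D (N + m)) (fun v => p v * h v) := by
  intro N v
  rw [abs_mul]
  calc (1 + ‖v‖) ^ N * (|p v| * |h v|)
      ≤ (1 + ‖v‖) ^ N * ((C * (1 + ‖v‖) ^ m) * |h v|) := by
        gcongr; exact hp v
    _ = C * ((1 + ‖v‖) ^ (N + m) * |h v|) := by ring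
    _ ≤ C * D (N + m) := mul_le_mul_of_nonneg_left (hh _ v) hp.nonneg

lemma RapidDecay.add {D D' : ℕ → ℝ} {h k : Vec3 → ℝ} (hh : RapidDecay D h)
    (hk : RapidDecay D' k) : RapidDecay (fun N => D N + D' N) (fun v => h v + k v) := by
  intro N v
  calc (1 + ‖v‖) ^ N * |h v + k v| ≤ (1 + ‖v‖) ^ N * (|h v| + |k v|) := by
        gcongr; exact abs_add_le _ _
    _ ≤ _ := by rw [mul_add]; exact add_le_add (hh N v) (hk N v)

lemma RapidDecay.sub {D D' : ℕ → ℝ} {h k : Vec3 → ℝ} (hh : RapidDecay D h)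
    (hk : RapidDecay D' k) : RapidDecay (fun N => D N + D' N) (fun v => h v - k v) := by
  intro N v
  calc (1 + ‖v‖) ^ N * |h v - k v| ≤ (1 + ‖v‖) ^ N * (|h v| + |k v|) := by
        gcongr; exact abs_sub _ _
    _ ≤ _ := by rw [mul_add]; exact add_le_add (hh N v) (hk N v)

lemma RapidDecay.sum {D : ℕ → ℝ} {h : Fin 3 → Vec3 → ℝ} (hh : ∀ i, RapidDecay D (h i)) :
    RapidDecay (fun N => 3 * D N) (fun v => ∑ i, h i v) := by
  intro N v
  calc (1 + ‖v‖) ^ N * |∑ i, h i v| ≤ (1 + ‖v‖) ^ N * ∑ i, |h i v| := by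
        gcongr; exact Finset.abs_sum_le_sum_abs _ _
    _ = ∑ i, (1 + ‖v‖) ^ N * |h i v| := Finset.mul_sum _ _ _
    _ ≤ ∑ _i : Fin 3, D N := Finset.sum_le_sum fun i _ => hh i N v
    _ = 3 * D N := by simp

lemma RapidDecay.mono {D D' : ℕ → ℝ} {h : Vec3 → ℝ} (hh : RapidDecay D h)
    (hD : ∀ N, D N ≤ D' N) : RapidDecay D' h := fun N v => (hh N v).trans (hD N)

/-- The exponent 4 is the first integer above the dimension 3; it recurs in all the decay estimates.
-/
lemma integrable_decayWeight {N : ℕ} (hN : 4 ≤ N) :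
    Integrable (fun v : Vec3 => ((1 + ‖v‖) ^ N)⁻¹) := by
  have h : Integrable (fun v : Vec3 => (1 + ‖v‖) ^ (-(N : ℝ))) := by
    refine integrable_one_add_norm ?_
    have : (4 : ℝ) ≤ N := by exact_mod_cast hN
    simp
    linarith
  refine h.congr (Filter.Eventually.of_forall fun v => ?_)
  simp [Real.rpow_neg (one_add_norm_pos v).le]

lemma RapidDecay.integrable {D : ℕ → ℝ} {h : Vec3 → ℝ} (hh : RapidDecay D h)
    (hm : AEStronglyMeasurable h volume) : Integrable h :=
  ((integrable_decayWeight le_rfl).const_mul (D 4)).mono' hm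
    (Filter.Eventually.of_forall fun v => hh.le_inv 4 v)

/-- Peetre's inequality: a weight centred at `v` is traded for one centred at the origin, at a
polynomial cost in `v`. -/
lemma one_add_norm_le_mul (v z : Vec3) : 1 + ‖z‖ ≤ (1 + ‖v‖) * (1 + ‖v - z‖) := by
  have : ‖z‖ ≤ ‖v‖ + ‖v - z‖ := by
    have := norm_sub_le v (v - z)
    simpa using this
  nlinarith [norm_nonneg v, norm_nonneg (v - z)]

lemma decayWeight_sub_le (N : ℕ) (v z : Vec3) :
    ((1 + ‖v - z‖) ^ N)⁻¹ ≤ (1 + ‖v‖) ^ N * ((1 + ‖z‖) ^ N)⁻¹ := by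
  rw [← div_eq_mul_inv, le_div_iff₀ (by positivity), inv_mul_le_iff₀ (by positivity), mul_comm,
    ← mul_pow]
  gcongr
  rw [mul_comm]
  exact (one_add_norm_le_mul v z).trans_eq (mul_comm _ _)

/-! ### Convolution with a kernel of size `2 / |z|` -/

/-- An integrable weight dominating a kernel of size `1 / |z|` against rapid decay. -/
def singularWeight (z : Vec3) : ℝ := ‖z‖⁻¹ * ((1 + ‖z‖) ^ 4)⁻¹

lemma singularWeight_nonneg (z : Vec3) : 0 ≤ singularWeight z := by
  unfold singularWeight; positivity

/-- In polar coordinates the Jacobian `r²` absorbs the singularity, leaving `r / (1 + r) ^ 4 ≤ 1 /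
(1 + r²)`. -/
lemma integrable_singularWeight : Integrable singularWeight := by
  have key := (integrable_fun_norm_addHaar (E := Vec3) volume
    (f := fun r : ℝ => r⁻¹ * ((1 + r) ^ 4)⁻¹)).2
  refine key ?_
  have hcong : Set.EqOn (fun y : ℝ => y ^ (Module.finrank ℝ Vec3 - 1) • (y⁻¹ * ((1 + y) ^ 4)⁻¹))
      (fun y => y * ((1 + y) ^ 4)⁻¹) (Set.Ioi 0) := by
    intro y hy
    have hy : 0 < y := hy
    simp
    field_simp
  rw [integrableOn_congr_fun hcong measurableSet_Ioi]
  have hint : IntegrableOn (fun y : ℝ => (1 + y ^ 2)⁻¹) (Set.Ioi 0) :=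
    integrable_inv_one_add_sq.integrableOn
  refine Integrable.mono' hint (Measurable.aestronglyMeasurable (by fun_prop)) ?_
  refine (ae_restrict_iff' measurableSet_Ioi).2 (Filter.Eventually.of_forall fun y hy => ?_)
  have hy : 0 < y := hy
  rw [Real.norm_of_nonneg (by positivity), ← div_eq_mul_inv, div_le_iff₀ (by positivity),
    inv_mul_eq_div, le_div_iff₀ (by positivity)]
  have : 0 ≤ (y ^ 4) := by positivity
  have : 0 ≤ (y ^ 3) := by positivity
  have : 0 ≤ (y ^ 2) := by positivity
  nlinarith

lemma kernel_mul_decay_le {k h : Vec3 → ℝ} {D : ℕ → ℝ} (hk : ∀ z, |k z| ≤ 2 * ‖z‖⁻¹)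
    (hh : RapidDecay D h) (v z : Vec3) :
    |k z * h (v - z)| ≤ 2 * D 4 * (1 + ‖v‖) ^ 4 * singularWeight z := by
  rw [abs_mul]
  have hD := hh.nonneg 4
  calc |k z| * |h (v - z)| ≤ (2 * ‖z‖⁻¹) * (D 4 * ((1 + ‖v - z‖) ^ 4)⁻¹) := by
        gcongr
        · exact hk z
        · exact hh.le_inv 4 _
    _ ≤ (2 * ‖z‖⁻¹) * (D 4 * ((1 + ‖v‖) ^ 4 * ((1 + ‖z‖) ^ 4)⁻¹)) := by
        gcongr
        exact decayWeight_sub_le 4 v z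
    _ = _ := by unfold singularWeight; ring

lemma integrable_kernel_mul' {k h : Vec3 → ℝ} {D : ℕ → ℝ} (hk : ∀ z, |k z| ≤ 2 * ‖z‖⁻¹)
    (hkm : Measurable k) (hh : RapidDecay D h) (hhm : Measurable h) (v : Vec3) :
    Integrable (fun z => k z * h (v - z)) := by
  refine (integrable_singularWeight.const_mul (2 * D 4 * (1 + ‖v‖) ^ 4)).mono'
    (Measurable.aestronglyMeasurable (by fun_prop)) (Filter.Eventually.of_forall fun z => ?_)
  exact kernel_mul_decay_le hk hh v z

lemma integrable_kernel_mul {k h : Vec3 → ℝ} {D : ℕ → ℝ} (hk : ∀ z, |k z| ≤ 2 * ‖z‖⁻¹)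
    (hkm : Measurable k) (hh : RapidDecay D h) (hhm : Measurable h) (v : Vec3) :
    Integrable (fun w => k (v - w) * h w) := by
  have := (integrable_kernel_mul' hk hkm hh hhm v).comp_sub_left v
  simpa using this

/-- With `z = v - w` as the variable, derivatives in `v` fall on the smooth `h` and never on the
singular kernel. -/
lemma kernel_integral_eq (k h : Vec3 → ℝ) (v : Vec3) :
    ∫ w, k (v - w) * h w = ∫ z, k z * h (v - z) := by
  have := integral_sub_left_eq_self (fun z => k z * h (v - z)) (volume : Measure Vec3) v
  simpa using this

lemma polyGrowth_kernel_integral {k h : Vec3 → ℝ} {D : ℕ → ℝ} (hk : ∀ z, |k z| ≤ 2 * ‖z‖⁻¹)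
    (hh : RapidDecay D h) :
    PolyGrowth (2 * D 4 * ∫ z, singularWeight z) 4 (fun v => ∫ w, k (v - w) * h w) := by
  intro v
  simp only [kernel_integral_eq]
  have := norm_integral_le_of_norm_le
    (integrable_singularWeight.const_mul (2 * D 4 * (1 + ‖v‖) ^ 4))
    (f := fun z => k z * h (v - z)) (Filter.Eventually.of_forall fun z => kernel_mul_decay_le hk hh v z)
  rw [integral_const_mul] at this
  calc _ ≤ _ := this
    _ = _ := by ring

lemma hasFDerivAt_kernel_integral {k h : Vec3 → ℝ} {D D' : ℕ → ℝ}
    (hk : ∀ z, |k z| ≤ 2 * ‖z‖⁻¹) (hkm : Measurable k) (hh : RapidDecay D h)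
    (hdiff : ContDiff ℝ 1 h) (hh' : ∀ i, RapidDecay D' (velPartial i h)) (v : Vec3) :
    HasFDerivAt (fun v => ∫ w, k (v - w) * h w) (∫ z, k z • fderiv ℝ h (v - z)) v := by
  simp only [kernel_integral_eq]
  have hcf : Continuous (fderiv ℝ h) := hdiff.continuous_fderiv (by simp)
  have hcm : Measurable (fderiv ℝ h) := hcf.measurable
  have hhm : Measurable h := hdiff.continuous.measurable
  -- On the unit ball around `v` one has `1 + ‖u‖ ≤ 2 + ‖v‖`, so the dominating function does not
  -- depend on `u`; the factor 3 counts the partial derivatives.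
  refine hasFDerivAt_integral_of_dominated_of_fderiv_le (Metric.ball_mem_nhds v one_pos)
    (F' := fun v z => k z • fderiv ℝ h (v - z))
    (bound := fun z => 3 * (2 * D' 4 * (2 + ‖v‖) ^ 4 * singularWeight z)) ?_ ?_ ?_ ?_ ?_ ?_
  · exact Filter.Eventually.of_forall fun u =>
      (integrable_kernel_mul' hk hkm hh hhm u).aestronglyMeasurable
  · exact integrable_kernel_mul' hk hkm hh hhm v
  · exact (hkm.smul (hcm.comp (measurable_const.sub measurable_id))).aestronglyMeasurable
  · refine Filter.Eventually.of_forall fun z u hu => ?_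
    have hu' : ‖u‖ ≤ 1 + ‖v‖ := by
      have h1 : ‖u - v‖ < 1 := by simpa [dist_eq_norm] using hu
      have h2 := norm_add_le (u - v) v
      rw [sub_add_cancel] at h2
      linarith
    rw [norm_smul]
    have hD := (hh' 0).nonneg 4
    calc ‖k z‖ * ‖fderiv ℝ h (u - z)‖ ≤ ‖k z‖ * ∑ i, |velPartial i h (u - z)| := by
          gcongr; exact norm_fderiv_le_sum _ _
      _ = ∑ i, |k z * velPartial i h (u - z)| := by
          rw [Finset.mul_sum]; simp [abs_mul]
      _ ≤ ∑ _i : Fin 3, 2 * D' 4 * (1 + ‖u‖) ^ 4 * singularWeight z :=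
          Finset.sum_le_sum fun i _ => kernel_mul_decay_le hk (hh' i) u z
      _ = 3 * (2 * D' 4 * (1 + ‖u‖) ^ 4 * singularWeight z) := by simp
      _ ≤ 3 * (2 * D' 4 * (2 + ‖v‖) ^ 4 * singularWeight z) := by
          have := singularWeight_nonneg z
          have h3 : (1 + ‖u‖) ^ 4 ≤ (2 + ‖v‖) ^ 4 :=
            pow_le_pow_left₀ (by positivity) (by linarith) 4
          exact mul_le_mul_of_nonneg_left (mul_le_mul_of_nonneg_right
            (mul_le_mul_of_nonneg_left h3 (by positivity)) this) (by norm_num)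
  · exact (integrable_singularWeight.const_mul _).const_mul _
  · refine Filter.Eventually.of_forall fun z u _ => ?_
    have h1 : HasFDerivAt h (fderiv ℝ h (u - z)) (u - z) :=
      (hdiff.differentiable (by simp) _).hasFDerivAt
    have h2 : HasFDerivAt (fun u => h (u - z)) (fderiv ℝ h (u - z)) u := by
      have := h1.comp u ((hasFDerivAt_id u).sub_const z)
      simpa [Function.comp_def] using this
    exact h2.const_smul (k z)

lemma differentiable_kernel_integral {k h : Vec3 → ℝ} {D D' : ℕ → ℝ}
    (hk : ∀ z, |k z| ≤ 2 * ‖z‖⁻¹) (hkm : Measurable k) (hh : RapidDecay D h)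
    (hdiff : ContDiff ℝ 1 h) (hh' : ∀ i, RapidDecay D' (velPartial i h)) :
    Differentiable ℝ (fun v => ∫ w, k (v - w) * h w) := fun v =>
  (hasFDerivAt_kernel_integral hk hkm hh hdiff hh' v).differentiableAt

lemma velPartial_kernel_integral {k h : Vec3 → ℝ} {D D' : ℕ → ℝ}
    (hk : ∀ z, |k z| ≤ 2 * ‖z‖⁻¹) (hkm : Measurable k) (hh : RapidDecay D h)
    (hdiff : ContDiff ℝ 1 h) (hh' : ∀ i, RapidDecay D' (velPartial i h)) (i : Fin 3) :
    velPartial i (fun v => ∫ w, k (v - w) * h w) =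
      fun v => ∫ w, k (v - w) * velPartial i h w := by
  ext v
  have hcf : Continuous (fderiv ℝ h) := hdiff.continuous_fderiv (by simp)
  have hcm : Measurable (fderiv ℝ h) := hcf.measurable
  have hint : Integrable (fun z => k z • fderiv ℝ h (v - z)) := by
    have hi : ∀ i, Integrable (fun z => |k z * velPartial i h (v - z)|) := fun i =>
      (integrable_kernel_mul' hk hkm (hh' i) (measurable_velPartial i h) v).abs
    refine (integrable_finsetSum Finset.univ fun i _ => hi i).mono' ?_ ?_
    · exact (hkm.smul (hcm.comp (measurable_const.sub measurable_id))).aestronglyMeasurable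
    · refine Filter.Eventually.of_forall fun z => ?_
      rw [norm_smul]
      refine (mul_le_mul_of_nonneg_left (norm_fderiv_le_sum _ _) (norm_nonneg _)).trans_eq ?_
      rw [Finset.mul_sum]; simp [abs_mul]
  rw [velPartial, (hasFDerivAt_kernel_integral hk hkm hh hdiff hh' v).fderiv,
    ContinuousLinearMap.integral_apply hint]
  simp only [kernel_integral_eq]
  rfl

/-! ### The Landau flux of a rapidly decaying profile -/

/-- A `C²` velocity profile whose derivatives up to order two decay rapidly with constants `D`. -/
structure VelocityProfile (D : ℕ → ℝ) (g : Vec3 → ℝ) : Prop where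
  contDiff : ContDiff ℝ 2 g
  decay : RapidDecay D g
  decay_partial : ∀ i, RapidDecay D (velPartial i g)
  decay_partial₂ : ∀ i j, RapidDecay D (velPartial i (velPartial j g))

lemma measurable_landauMatrix (i j : Fin 3) :
    Measurable (fun z => landauMatrix coulombKernel z i j) := by
  unfold landauMatrix coulombKernel
  simp only [Matrix.of_apply]
  split_ifs <;> fun_prop

/-- Both terms of `A(z)` are at most `|z|⁻³ |z|²`, so the singularity is `2 / |z|`, locally
integrable in dimension 3. At `z = 0` both sides are zero because `0⁻¹ = 0`. -/
lemma abs_landauMatrix_le (i j : Fin 3) (z : Vec3) :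
    |landauMatrix coulombKernel z i j| ≤ 2 * ‖z‖⁻¹ := by
  simp only [landauMatrix, coulombKernel, Matrix.of_apply]
  rcases eq_or_ne z 0 with rfl | hz
  · simp
  have hz' : 0 < ‖z‖ := norm_pos_iff.2 hz
  rw [abs_mul, abs_of_pos (by positivity), inv_mul_le_iff₀ (by positivity)]
  have h1 : |z i * z j| ≤ ‖z‖ * ‖z‖ := by
    rw [abs_mul]
    exact mul_le_mul (abs_coord_le z i) (abs_coord_le z j) (abs_nonneg _) (norm_nonneg _)
  have h2 : |if i = j then ‖z‖ ^ 2 else 0| ≤ ‖z‖ ^ 2 := by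
    split_ifs
    · rw [abs_of_nonneg (by positivity)]
    · simp
  calc _ ≤ _ := abs_sub _ _
    _ ≤ ‖z‖ ^ 2 + ‖z‖ * ‖z‖ := add_le_add h2 h1
    _ = ‖z‖ ^ 3 * (2 * ‖z‖⁻¹) := by field_simp; ring

lemma landauMatrix_neg (z : Vec3) :
    landauMatrix coulombKernel (-z) = landauMatrix coulombKernel z := by
  ext i j
  simp [landauMatrix]

/-- Convolution with an entry of the Landau matrix. -/
def landauConv (i j : Fin 3) (h : Vec3 → ℝ) (v : Vec3) : ℝ :=
  ∫ w, landauMatrix coulombKernel (v - w) i j * h w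

/-- The constant bounding convolutions with the Landau matrix. -/
def landauConvConst (D : ℕ → ℝ) : ℝ := 2 * D 4 * ∫ z, singularWeight z

lemma polyGrowth_landauConv (i j : Fin 3) {D : ℕ → ℝ} {h : Vec3 → ℝ} (hh : RapidDecay D h) :
    PolyGrowth (landauConvConst D) 4 (landauConv i j h) :=
  polyGrowth_kernel_integral (abs_landauMatrix_le i j) hh

lemma differentiable_landauConv (i j : Fin 3) {D : ℕ → ℝ} {h : Vec3 → ℝ} (hh : RapidDecay D h)
    (hdiff : ContDiff ℝ 1 h) (hh' : ∀ i, RapidDecay D (velPartial i h)) :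
    Differentiable ℝ (landauConv i j h) :=
  differentiable_kernel_integral (abs_landauMatrix_le i j) (measurable_landauMatrix i j) hh hdiff
    hh'

lemma velPartial_landauConv (i j l : Fin 3) {D : ℕ → ℝ} {h : Vec3 → ℝ} (hh : RapidDecay D h)
    (hdiff : ContDiff ℝ 1 h) (hh' : ∀ i, RapidDecay D (velPartial i h)) :
    velPartial l (landauConv i j h) = landauConv i j (velPartial l h) :=
  velPartial_kernel_integral (abs_landauMatrix_le i j) (measurable_landauMatrix i j) hh hdiff
    hh' l

namespace VelocityProfile

variable {D : ℕ → ℝ} {g : Vec3 → ℝ}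

lemma differentiable (hg : VelocityProfile D g) : Differentiable ℝ g :=
  hg.contDiff.differentiable (by simp)

lemma contDiff_partial (hg : VelocityProfile D g) (i : Fin 3) :
    ContDiff ℝ 1 (velPartial i g) :=
  ContDiff.velPartial hg.contDiff (by norm_num) i

lemma differentiable_partial (hg : VelocityProfile D g) (i : Fin 3) :
    Differentiable ℝ (velPartial i g) :=
  (hg.contDiff_partial i).differentiable (by simp)

/-- Once split into products of convolutions with `g` or its derivatives, the flux can be
differentiated and estimated factor by factor. -/
lemma landauFlux_eq (hg : VelocityProfile D g) (i : Fin 3) :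
    landauFlux coulombKernel g i = fun v => ∑ j,
      (landauConv i j g v * velPartial j g v - g v * landauConv i j (velPartial j g) v) := by
  ext v
  have h1 : ∀ j, Integrable (fun w => landauMatrix coulombKernel (v - w) i j * g w) := fun j =>
    integrable_kernel_mul (abs_landauMatrix_le i j) (measurable_landauMatrix i j) hg.decay
      hg.contDiff.continuous.measurable v
  have h2 : ∀ j, Integrable
      (fun w => landauMatrix coulombKernel (v - w) i j * velPartial j g w) := fun j =>
    integrable_kernel_mul (abs_landauMatrix_le i j) (measurable_landauMatrix i j)
      (hg.decay_partial j) (measurable_velPartial j g) v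
  have h3 : ∀ w, ∑ j, landauMatrix coulombKernel (v - w) i j *
        (g w * velPartial j g v - g v * velPartial j g w) =
      ∑ j, ((landauMatrix coulombKernel (v - w) i j * g w) * velPartial j g v -
        g v * (landauMatrix coulombKernel (v - w) i j * velPartial j g w)) := fun w =>
    Finset.sum_congr rfl fun j _ => by ring
  have h4 : ∀ j, Integrable (fun w =>
      (landauMatrix coulombKernel (v - w) i j * g w) * velPartial j g v -
        g v * (landauMatrix coulombKernel (v - w) i j * velPartial j g w)) := fun j =>
    ((h1 j).mul_const _).sub ((h2 j).const_mul _)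
  simp only [landauFlux, h3, landauConv]
  rw [integral_finsetSum _ fun j _ => h4 j]
  refine Finset.sum_congr rfl fun j _ => ?_
  rw [integral_sub ((h1 j).mul_const _) ((h2 j).const_mul _), integral_mul_const,
    integral_const_mul]

lemma differentiable_landauConv (hg : VelocityProfile D g) (i j : Fin 3) :
    Differentiable ℝ (landauConv i j g) :=
  _root_.differentiable_landauConv i j hg.decay (hg.contDiff.of_le (by norm_num))
    hg.decay_partial

lemma differentiable_landauConv_partial (hg : VelocityProfile D g) (i j l : Fin 3) :
    Differentiable ℝ (landauConv i j (velPartial l g)) :=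
  _root_.differentiable_landauConv i j (hg.decay_partial l) (hg.contDiff_partial l)
    fun m => hg.decay_partial₂ m l

lemma differentiable_landauFlux (hg : VelocityProfile D g) (i : Fin 3) :
    Differentiable ℝ (landauFlux coulombKernel g i) := by
  rw [hg.landauFlux_eq i]
  exact Differentiable.fun_sum fun j _ =>
    ((hg.differentiable_landauConv i j).mul (hg.differentiable_partial j)).sub
      (hg.differentiable.mul (hg.differentiable_landauConv_partial i j j))

/-- Decay constants of the Landau flux. -/
def fluxDecay (D : ℕ → ℝ) (N : ℕ) : ℝ :=
  12 * (landauConvConst D * D (N + 4))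

lemma landauConvConst_mul_nonneg (hg : VelocityProfile D g) (N : ℕ) :
    0 ≤ landauConvConst D * D (N + 4) :=
  mul_nonneg (polyGrowth_landauConv 0 0 hg.decay).nonneg (hg.decay.nonneg _)

lemma rapidDecay_landauFlux (hg : VelocityProfile D g) (i : Fin 3) :
    RapidDecay (fluxDecay D) (landauFlux coulombKernel g i) := by
  rw [hg.landauFlux_eq i]
  have h := RapidDecay.sum (h := fun j v => landauConv i j g v * velPartial j g v -
    g v * landauConv i j (velPartial j g) v) fun j =>
    ((hg.decay_partial j).mul_poly (polyGrowth_landauConv i j hg.decay)).sub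
      (by simpa [mul_comm] using
        (hg.decay.mul_poly (polyGrowth_landauConv i j (hg.decay_partial j))))
  refine h.mono fun N => ?_
  have := hg.landauConvConst_mul_nonneg N
  simp only [fluxDecay]
  nlinarith

lemma velPartial_landauFlux (hg : VelocityProfile D g) (i l : Fin 3) :
    velPartial l (landauFlux coulombKernel g i) = fun v => ∑ j,
      ((landauConv i j g v * velPartial l (velPartial j g) v +
          landauConv i j (velPartial l g) v * velPartial j g v) -
        (landauConv i j (velPartial l (velPartial j g)) v * g v +
          landauConv i j (velPartial j g) v * velPartial l g v)) := by
  ext v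
  have hA := fun j => hg.differentiable_landauConv i j v
  have hB := fun j => hg.differentiable_partial j v
  have hC := hg.differentiable v
  have hE := fun j => hg.differentiable_landauConv_partial i j j v
  rw [hg.landauFlux_eq i, velPartial_sum l fun j => ((hA j).fun_mul (hB j)).fun_sub (hC.fun_mul (hE j))]
  refine Finset.sum_congr rfl fun j _ => ?_
  rw [velPartial_sub l ((hA j).fun_mul (hB j)) (hC.fun_mul (hE j)), velPartial_mul l (hA j) (hB j),
    velPartial_mul l hC (hE j),
    _root_.velPartial_landauConv i j l hg.decay (hg.contDiff.of_le (by norm_num))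
      hg.decay_partial,
    _root_.velPartial_landauConv i j l (hg.decay_partial j) (hg.contDiff_partial j)
      fun m => hg.decay_partial₂ m j]
  ring

lemma rapidDecay_velPartial_landauFlux (hg : VelocityProfile D g) (i l : Fin 3) :
    RapidDecay (fluxDecay D) (velPartial l (landauFlux coulombKernel g i)) := by
  rw [hg.velPartial_landauFlux i l]
  have h := RapidDecay.sum (h := fun j v =>
      (landauConv i j g v * velPartial l (velPartial j g) v +
          landauConv i j (velPartial l g) v * velPartial j g v) -
        (landauConv i j (velPartial l (velPartial j g)) v * g v +
          landauConv i j (velPartial j g) v * velPartial l g v)) fun j =>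
    (((hg.decay_partial₂ l j).mul_poly (polyGrowth_landauConv i j hg.decay)).add
      ((hg.decay_partial j).mul_poly (polyGrowth_landauConv i j (hg.decay_partial l)))).sub
    ((hg.decay.mul_poly (polyGrowth_landauConv i j (hg.decay_partial₂ l j))).add
      ((hg.decay_partial l).mul_poly (polyGrowth_landauConv i j (hg.decay_partial j))))
  -- Four products, each bounded by `landauConvConst D * D (N + 4)`, summed over three values of
  -- `j`: this is the 12 in `fluxDecay`.
  refine h.mono fun N => ?_
  simp only [fluxDecay]
  linarith

lemma rapidDecay_landauOperator (hg : VelocityProfile D g) :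
    RapidDecay (fun N => 3 * fluxDecay D N) (landauOperator coulombKernel g) :=
  RapidDecay.sum fun i => hg.rapidDecay_velPartial_landauFlux i i

lemma measurable_landauOperator (Ψ : ℝ → ℝ) (g : Vec3 → ℝ) :
    Measurable (landauOperator Ψ g) := by
  unfold landauOperator
  exact Finset.measurable_sum _ fun i _ => measurable_velPartial i _

end VelocityProfile

/-! ### The logarithm of a profile -/

/-- A strictly positive profile with polynomially bounded score and logarithm. -/
structure PositiveProfile (D : ℕ → ℝ) (C : ℝ) (K : ℕ) (g : Vec3 → ℝ) : Prop
    extends VelocityProfile D g where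
  pos : ∀ v, 0 < g v
  score_bound : ∀ v i, |velPartial i g v| ≤ C * (1 + ‖v‖) ^ K * g v

/-- The score `∂ᵢ log g`. -/
def velScore (g : Vec3 → ℝ) (i : Fin 3) (v : Vec3) : ℝ := velPartial i g v / g v

namespace PositiveProfile

variable {D : ℕ → ℝ} {C : ℝ} {K : ℕ} {g : Vec3 → ℝ}

lemma polyGrowth_score (hg : PositiveProfile D C K g) (i : Fin 3) :
    PolyGrowth C K (velScore g i) := by
  intro v
  rw [velScore, abs_div, abs_of_pos (hg.pos v), div_le_iff₀ (hg.pos v)]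
  exact hg.score_bound v i

lemma velPartial_log (hg : PositiveProfile D C K g) (i : Fin 3) (v : Vec3) :
    velPartial i (fun v => Real.log (g v)) v = velScore g i v :=
  _root_.velPartial_log i (hg.differentiable v) (hg.pos v).ne'

lemma differentiable_log (hg : PositiveProfile D C K g) :
    Differentiable ℝ (fun v => Real.log (g v)) :=
  hg.differentiable.log fun v => (hg.pos v).ne'

/-- The mean value inequality on the ball of radius `‖v‖` integrates the score bound, at the price
of one power. This controls `log g` where `g` is tiny and makes the entropy integrals converge. -/
lemma polyGrowth_log (hg : PositiveProfile D C K g) :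
    PolyGrowth (|Real.log (g 0)| + 3 * C) (K + 1) (fun v => Real.log (g v)) := by
  intro v
  have hC : 0 ≤ C := (hg.polyGrowth_score 0).nonneg
  have hb : ∀ u ∈ Metric.closedBall (0 : Vec3) ‖v‖,
      ‖fderiv ℝ (fun v => Real.log (g v)) u‖ ≤ 3 * C * (1 + ‖v‖) ^ K := by
    intro u hu
    have hu : ‖u‖ ≤ ‖v‖ := by simpa using hu
    calc _ ≤ _ := norm_fderiv_le_sum _ _
      _ ≤ ∑ _i : Fin 3, C * (1 + ‖v‖) ^ K := Finset.sum_le_sum fun i _ => by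
          rw [hg.velPartial_log]
          refine (hg.polyGrowth_score i u).trans ?_
          gcongr
      _ = _ := by simp; ring
  have h := (convex_closedBall (0 : Vec3) ‖v‖).norm_image_sub_le_of_norm_fderiv_le
    (fun u _ => hg.differentiable_log u) hb (x := 0) (y := v) (by simp) (by simp)
  rw [sub_zero, Real.norm_eq_abs] at h
  have h1 : |Real.log (g v)| ≤ |Real.log (g 0)| + |Real.log (g v) - Real.log (g 0)| := by
    have := abs_add_le (Real.log (g 0)) (Real.log (g v) - Real.log (g 0))
    simpa using this
  have h2 : (1 : ℝ) ≤ (1 + ‖v‖) ^ (K + 1) := one_le_pow₀ (by simp)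
  have h3 : 3 * C * (1 + ‖v‖) ^ K * ‖v‖ ≤ 3 * C * (1 + ‖v‖) ^ (K + 1) := by
    rw [pow_succ, ← mul_assoc]
    gcongr
    linarith
  nlinarith [abs_nonneg (Real.log (g 0))]

end PositiveProfile

/-! ### The H-theorem -/

/-- Of the eight powers of decay in `w`, four are kept for integrability and four combine with the
decay in `v` to give decay in `v - w`. The result is dominated by a convolution integrand of two
integrable weights. -/
lemma integrable_kernel_mul_mul {k p q : Vec3 → ℝ} {D D' : ℕ → ℝ}
    (hk : ∀ z, |k z| ≤ 2 * ‖z‖⁻¹) (hkm : Measurable k) (hp : RapidDecay D p)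
    (hpm : Measurable p) (hq : RapidDecay D' q) (hqm : Measurable q) :
    Integrable (fun x : Vec3 × Vec3 => k (x.1 - x.2) * (p x.1 * q x.2))
      ((volume : Measure Vec3).prod volume) := by
  have h := (integrable_decayWeight le_rfl).convolution_integrand
    (ContinuousLinearMap.mul ℝ ℝ) integrable_singularWeight
  refine (h.const_mul (2 * D 4 * D' 8)).mono' (Measurable.aestronglyMeasurable (by fun_prop))
    (Filter.Eventually.of_forall fun x => ?_)
  obtain ⟨v, w⟩ := x
  have hD := hp.nonneg 4
  have hD' := hq.nonneg 8
  have hz : (1 + ‖v - w‖) ^ 4 ≤ (1 + ‖v‖) ^ 4 * (1 + ‖w‖) ^ 4 := by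
    rw [← mul_pow]
    gcongr
    nlinarith [norm_sub_le v w, norm_nonneg v, norm_nonneg w]
  simp only [ContinuousLinearMap.mul_apply', norm_mul, Real.norm_eq_abs, singularWeight]
  calc |k (v - w)| * (|p v| * |q w|)
      ≤ (2 * ‖v - w‖⁻¹) * ((D 4 * ((1 + ‖v‖) ^ 4)⁻¹) * (D' 8 * ((1 + ‖w‖) ^ 8)⁻¹)) := by
        gcongr
        · exact hk _
        · exact hp.le_inv 4 v
        · exact hq.le_inv 8 w
    _ = 2 * D 4 * D' 8 * (((1 + ‖w‖) ^ 4)⁻¹ *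
        (‖v - w‖⁻¹ * ((1 + ‖v‖) ^ 4 * (1 + ‖w‖) ^ 4)⁻¹)) := by
        field_simp
    _ ≤ 2 * D 4 * D' 8 * (((1 + ‖w‖) ^ 4)⁻¹ * (‖v - w‖⁻¹ * ((1 + ‖v - w‖) ^ 4)⁻¹)) := by
        gcongr

/-- The density of the entropy dissipation of the Landau operator. -/
def dissipationDensity (g : Vec3 → ℝ) (x : Vec3 × Vec3) : ℝ :=
  ∑ i, ∑ j, landauMatrix coulombKernel (x.1 - x.2) i j *
    ((velScore g j x.1 - velScore g j x.2) * (velScore g i x.1 - velScore g i x.2)) *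
      (g x.1 * g x.2)

/-- The flux contracted with the score, before symmetrization. -/
def fluxScoreDensity (g : Vec3 → ℝ) (x : Vec3 × Vec3) : ℝ :=
  ∑ i, ∑ j, landauMatrix coulombKernel (x.1 - x.2) i j *
    ((velScore g i x.1 * velPartial j g x.1) * g x.2 -
      (velScore g i x.1 * g x.1) * velPartial j g x.2)

/-- Lagrange's identity `|z|² |d|² - (z · d)² = |z × d|²`: the form is nonnegative and degenerates
only when `d` is parallel to `z`. -/
lemma landauMatrix_quadratic (z d : Vec3) :
    ∑ i, ∑ j, landauMatrix coulombKernel z i j * (d j * d i) =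
      (‖z‖ ^ 3)⁻¹ * ((z 0 * d 1 - z 1 * d 0) ^ 2 + (z 0 * d 2 - z 2 * d 0) ^ 2 +
        (z 1 * d 2 - z 2 * d 1) ^ 2) := by
  have hz : ‖z‖ ^ 2 = z 0 ^ 2 + z 1 ^ 2 + z 2 ^ 2 := by
    rw [EuclideanSpace.norm_sq_eq]
    simp [Fin.sum_univ_three]
  simp only [landauMatrix, coulombKernel, Matrix.of_apply, Fin.sum_univ_three, hz]
  simp
  ring

lemma dissipationDensity_eq (g : Vec3 → ℝ) (v w : Vec3) :
    dissipationDensity g (v, w) = (‖v - w‖ ^ 3)⁻¹ *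
      (((v 0 - w 0) * (velScore g 1 v - velScore g 1 w) -
          (v 1 - w 1) * (velScore g 0 v - velScore g 0 w)) ^ 2 +
        ((v 0 - w 0) * (velScore g 2 v - velScore g 2 w) -
          (v 2 - w 2) * (velScore g 0 v - velScore g 0 w)) ^ 2 +
        ((v 1 - w 1) * (velScore g 2 v - velScore g 2 w) -
          (v 2 - w 2) * (velScore g 1 v - velScore g 1 w)) ^ 2) * (g v * g w) := by
  have h := landauMatrix_quadratic (v - w)
    (WithLp.toLp 2 fun i => velScore g i v - velScore g i w)
  simp only [PiLp.sub_apply] at h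
  rw [← h, dissipationDensity]
  simp only [Finset.sum_mul]

/-! ### Symmetrization and the entropy dissipation identity -/

namespace PositiveProfile

variable {D : ℕ → ℝ} {C : ℝ} {K : ℕ} {g : Vec3 → ℝ}

lemma measurable (hg : PositiveProfile D C K g) : Measurable g :=
  hg.contDiff.continuous.measurable

lemma continuous_score (hg : PositiveProfile D C K g) (i : Fin 3) :
    Continuous (velScore g i) :=
  (hg.contDiff_partial i).continuous.div hg.contDiff.continuous fun v => (hg.pos v).ne'

lemma integrable_fluxScoreTerm (hg : PositiveProfile D C K g) (i j : Fin 3) :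
    Integrable (fun x : Vec3 × Vec3 => landauMatrix coulombKernel (x.1 - x.2) i j *
      ((velScore g i x.1 * velPartial j g x.1) * g x.2 -
        (velScore g i x.1 * g x.1) * velPartial j g x.2))
      ((volume : Measure Vec3).prod volume) := by
  have hk := abs_landauMatrix_le i j
  have hkm := measurable_landauMatrix i j
  have hsm := (hg.continuous_score i).measurable
  have h1 := integrable_kernel_mul_mul hk hkm
    ((hg.decay_partial j).mul_poly (hg.polyGrowth_score i))
    (hsm.mul (measurable_velPartial j g)) hg.decay hg.measurable
  have h2 := integrable_kernel_mul_mul hk hkm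
    (hg.decay.mul_poly (hg.polyGrowth_score i))
    (hsm.mul hg.measurable) (hg.decay_partial j) (measurable_velPartial j g)
  refine (h1.sub h2).congr (Filter.Eventually.of_forall fun x => ?_)
  simp only [Pi.sub_apply]
  ring

lemma integrable_fluxScoreDensity (hg : PositiveProfile D C K g) :
    Integrable (fluxScoreDensity g) ((volume : Measure Vec3).prod volume) :=
  integrable_finsetSum _ fun i _ => integrable_finsetSum _ fun j _ =>
    hg.integrable_fluxScoreTerm i j

lemma partial_eq (hg : PositiveProfile D C K g) (i : Fin 3) (v : Vec3) :
    velPartial i g v = velScore g i v * g v := by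
  rw [velScore, div_mul_cancel₀ _ (hg.pos v).ne']

/-- The kernel is even and the bracket in the flux is odd under exchange of `v` and `w`, so adding
the two copies turns the score into a score difference. -/
lemma fluxScoreDensity_add_swap (hg : PositiveProfile D C K g) (x : Vec3 × Vec3) :
    fluxScoreDensity g x + fluxScoreDensity g x.swap = dissipationDensity g x := by
  obtain ⟨v, w⟩ := x
  simp only [fluxScoreDensity, dissipationDensity, Prod.swap_prod_mk, ← Finset.sum_add_distrib]
  refine Finset.sum_congr rfl fun i _ => Finset.sum_congr rfl fun j _ => ?_
  rw [show w - v = -(v - w) by abel, landauMatrix_neg]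
  simp only [hg.partial_eq]
  ring

lemma integrable_dissipationDensity (hg : PositiveProfile D C K g) :
    Integrable (dissipationDensity g) ((volume : Measure Vec3).prod volume) := by
  refine (hg.integrable_fluxScoreDensity.add hg.integrable_fluxScoreDensity.swap).congr
    (Filter.Eventually.of_forall fun x => ?_)
  exact hg.fluxScoreDensity_add_swap x

lemma integral_dissipationDensity (hg : PositiveProfile D C K g) :
    ∫ x, dissipationDensity g x ∂((volume : Measure Vec3).prod volume) =
      2 * ∫ x, fluxScoreDensity g x ∂((volume : Measure Vec3).prod volume) := by
  have hswap : Integrable (fun x : Vec3 × Vec3 => fluxScoreDensity g x.swap)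
      ((volume : Measure Vec3).prod volume) := hg.integrable_fluxScoreDensity.swap
  simp only [← hg.fluxScoreDensity_add_swap]
  rw [integral_add hg.integrable_fluxScoreDensity hswap, integral_prod_swap]
  ring

lemma dissipationDensity_nonneg (hg : PositiveProfile D C K g) (x : Vec3 × Vec3) :
    0 ≤ dissipationDensity g x := by
  obtain ⟨v, w⟩ := x
  rw [dissipationDensity_eq]
  have := hg.pos v
  have := hg.pos w
  positivity

lemma integral_fluxScoreDensity_right (hg : PositiveProfile D C K g) (v : Vec3) :
    ∫ w, fluxScoreDensity g (v, w) =
      ∑ i, landauFlux coulombKernel g i v * velScore g i v := by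
  have hi : ∀ i j, Integrable (fun w => landauMatrix coulombKernel (v - w) i j *
      (g w * velPartial j g v - g v * velPartial j g w)) := by
    intro i j
    have h1 := integrable_kernel_mul (abs_landauMatrix_le i j) (measurable_landauMatrix i j)
      hg.decay hg.measurable v
    have h2 := integrable_kernel_mul (abs_landauMatrix_le i j) (measurable_landauMatrix i j)
      (hg.decay_partial j) (measurable_velPartial j g) v
    refine ((h1.mul_const (velPartial j g v)).sub (h2.mul_const (g v))).congr
      (Filter.Eventually.of_forall fun w => ?_)
    simp only [Pi.sub_apply]
    ring
  have hs : ∀ i, Integrable (fun w => ∑ j, landauMatrix coulombKernel (v - w) i j *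
      (g w * velPartial j g v - g v * velPartial j g w)) := fun i =>
    integrable_finsetSum _ fun j _ => hi i j
  have he : ∀ w, fluxScoreDensity g (v, w) =
      ∑ i, (∑ j, landauMatrix coulombKernel (v - w) i j *
        (g w * velPartial j g v - g v * velPartial j g w)) * velScore g i v := by
    intro w
    simp only [fluxScoreDensity, Finset.sum_mul]
    refine Finset.sum_congr rfl fun i _ => Finset.sum_congr rfl fun j _ => ?_
    ring
  simp only [he, landauFlux]
  rw [integral_finsetSum _ fun i _ => (hs i).mul_const _]
  exact Finset.sum_congr rfl fun i _ => integral_mul_const _ _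

lemma integrable_landauOperator_mul_log (hg : PositiveProfile D C K g) :
    Integrable (fun v => Real.log (g v) * landauOperator coulombKernel g v) :=
  (hg.rapidDecay_landauOperator.mul_poly hg.polyGrowth_log).integrable
    (hg.differentiable_log.continuous.measurable.mul
      (VelocityProfile.measurable_landauOperator _ _)).aestronglyMeasurable

/-- Entropy dissipation of the Landau operator. -/
theorem integral_log_mul_landauOperator (hg : PositiveProfile D C K g) :
    ∫ v, Real.log (g v) * landauOperator coulombKernel g v =
      -(1 / 2) * ∫ x, dissipationDensity g x ∂((volume : Measure Vec3).prod volume) := by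
  have hlm := hg.differentiable_log.continuous.measurable
  have hJm : ∀ i, Measurable (landauFlux coulombKernel g i) := fun i =>
    (hg.differentiable_landauFlux i).continuous.measurable
  have i1 : ∀ i, Integrable fun v =>
      Real.log (g v) * velPartial i (landauFlux coulombKernel g i) v := fun i =>
    ((hg.rapidDecay_velPartial_landauFlux i i).mul_poly hg.polyGrowth_log).integrable
      (hlm.mul (measurable_velPartial i _)).aestronglyMeasurable
  have i2 : ∀ i, Integrable fun v => velScore g i v * landauFlux coulombKernel g i v := fun i =>
    ((hg.rapidDecay_landauFlux i).mul_poly (hg.polyGrowth_score i)).integrable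
      ((hg.continuous_score i).measurable.mul (hJm i)).aestronglyMeasurable
  have i3 : ∀ i, Integrable fun v => Real.log (g v) * landauFlux coulombKernel g i v := fun i =>
    ((hg.rapidDecay_landauFlux i).mul_poly hg.polyGrowth_log).integrable
      (hlm.mul (hJm i)).aestronglyMeasurable
  -- Integration by parts on the whole space; `i1`, `i2`, `i3` make the boundary term vanish.
  have hparts : ∀ i, ∫ v, Real.log (g v) * velPartial i (landauFlux coulombKernel g i) v =
      -∫ v, velScore g i v * landauFlux coulombKernel g i v := by
    intro i
    have hs : (fun v => velScore g i v * landauFlux coulombKernel g i v) = fun v =>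
        fderiv ℝ (fun v => Real.log (g v)) v (EuclideanSpace.single i 1) *
          landauFlux coulombKernel g i v := by
      ext v
      rw [← hg.velPartial_log i v]
      rfl
    have h := integral_mul_fderiv_eq_neg_fderiv_mul_of_integrable (μ := volume)
      (f := fun v => Real.log (g v)) (g := landauFlux coulombKernel g i)
      (v := EuclideanSpace.single i 1) (hs ▸ i2 i) (i1 i) (i3 i)
      (fun v _ => hg.differentiable_log v) (fun v _ => hg.differentiable_landauFlux i v)
    rw [hs]
    exact h
  have hQ : ∀ v, Real.log (g v) * landauOperator coulombKernel g v =
      ∑ i, Real.log (g v) * velPartial i (landauFlux coulombKernel g i) v := fun v => by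
    rw [landauOperator, Finset.mul_sum]
  simp only [hQ]
  rw [integral_finsetSum _ fun i _ => i1 i]
  simp only [hparts]
  rw [Finset.sum_neg_distrib, ← integral_finsetSum _ fun i _ => i2 i,
    hg.integral_dissipationDensity, integral_prod _ hg.integrable_fluxScoreDensity]
  simp only [hg.integral_fluxScoreDensity_right]
  simp only [mul_comm (velScore g _ _)]
  ring

lemma integral_log_mul_landauOperator_nonpos (hg : PositiveProfile D C K g) :
    ∫ v, Real.log (g v) * landauOperator coulombKernel g v ≤ 0 := by
  rw [hg.integral_log_mul_landauOperator]
  have := integral_nonneg_of_ae (μ := (volume : Measure Vec3).prod volume)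
    (Filter.Eventually.of_forall hg.dissipationDensity_nonneg)
  linarith

lemma eq_zero_of_sum_three_sq {a b c : ℝ} (h : a ^ 2 + b ^ 2 + c ^ 2 = 0) :
    a = 0 ∧ b = 0 ∧ c = 0 := by
  have ha : a ^ 2 = 0 := by nlinarith [sq_nonneg a, sq_nonneg b, sq_nonneg c]
  have hb : b ^ 2 = 0 := by nlinarith [sq_nonneg a, sq_nonneg b, sq_nonneg c]
  have hc : c ^ 2 = 0 := by nlinarith [sq_nonneg a, sq_nonneg b, sq_nonneg c]
  exact ⟨pow_eq_zero_iff two_ne_zero |>.1 ha, pow_eq_zero_iff two_ne_zero |>.1 hb,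
    pow_eq_zero_iff two_ne_zero |>.1 hc⟩

/-- If the entropy dissipation vanishes, score differences are collinear with velocity
differences. -/
theorem collinear_of_dissipation_eq_zero (hg : PositiveProfile D C K g)
    (h0 : ∫ v, Real.log (g v) * landauOperator coulombKernel g v = 0) (i j : Fin 3)
    (v w : Vec3) :
    (v i - w i) * (velScore g j v - velScore g j w) =
      (v j - w j) * (velScore g i v - velScore g i w) := by
  rw [hg.integral_log_mul_landauOperator] at h0
  have h1 : ∫ x, dissipationDensity g x ∂((volume : Measure Vec3).prod volume) = 0 := by linarith
  rw [integral_eq_zero_iff_of_nonneg hg.dissipationDensity_nonneg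
    hg.integrable_dissipationDensity] at h1
  -- `G` is the dissipation density without its positive factors, among them the one singular on the
  -- diagonal. It is continuous, so vanishing almost everywhere becomes vanishing everywhere.
  let G : Vec3 × Vec3 → ℝ := fun x =>
    ((x.1 0 - x.2 0) * (velScore g 1 x.1 - velScore g 1 x.2) -
          (x.1 1 - x.2 1) * (velScore g 0 x.1 - velScore g 0 x.2)) ^ 2 +
        ((x.1 0 - x.2 0) * (velScore g 2 x.1 - velScore g 2 x.2) -
          (x.1 2 - x.2 2) * (velScore g 0 x.1 - velScore g 0 x.2)) ^ 2 +
        ((x.1 1 - x.2 1) * (velScore g 2 x.1 - velScore g 2 x.2) -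
          (x.1 2 - x.2 2) * (velScore g 1 x.1 - velScore g 1 x.2)) ^ 2
  have hs := hg.continuous_score
  have hG : Continuous G := by
    have := hs 0
    have := hs 1
    have := hs 2
    fun_prop
  have hae : G =ᵐ[(volume : Measure Vec3).prod volume] fun _ => 0 := by
    filter_upwards [h1] with x hx
    obtain ⟨v, w⟩ := x
    rw [dissipationDensity_eq] at hx
    rcases eq_or_ne v w with rfl | hvw
    · simp [G]
    have h2 : (‖v - w‖ ^ 3)⁻¹ ≠ 0 := by
      have := norm_pos_iff.2 (sub_ne_zero.2 hvw)
      positivity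
    have h3 := (hg.pos v).ne'
    have h4 := (hg.pos w).ne'
    simpa [h2, h3, h4] using hx
  have hG0 : G (v, w) = 0 := congrFun (hG.ae_eq_iff_eq _ continuous_const |>.1 hae) (v, w)
  simp only [G] at hG0
  obtain ⟨e01, e02, e12⟩ := eq_zero_of_sum_three_sq hG0
  fin_cases i <;> fin_cases j <;> simp only [Fin.zero_eta, Fin.mk_one, Fin.reduceFinMk] <;>
    linarith

end PositiveProfile

/-! ### The Lorentz force term -/

lemma cross_apply_zero (v w : Vec3) : cross v w 0 = v 1 * w 2 - v 2 * w 1 := by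
  simp [cross, cross_apply]

lemma cross_apply_one (v w : Vec3) : cross v w 1 = v 2 * w 0 - v 0 * w 2 := by
  simp [cross, cross_apply]

lemma cross_apply_two (v w : Vec3) : cross v w 2 = v 0 * w 1 - v 1 * w 0 := by
  simp [cross, cross_apply]

/-- The Lorentz force `E + v × B`, as a function of the velocity. -/
def lorentz (E B : Vec3) (i : Fin 3) (v : Vec3) : ℝ := (E + cross v B) i

lemma differentiable_coord (i : Fin 3) : Differentiable ℝ (fun v : Vec3 => v i) :=
  (EuclideanSpace.proj (𝕜 := ℝ) i : Vec3 →L[ℝ] ℝ).differentiable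

lemma differentiable_lorentz (E B : Vec3) (i : Fin 3) : Differentiable ℝ (lorentz E B i) := by
  have := differentiable_coord
  unfold lorentz
  fin_cases i <;>
    simp only [PiLp.add_apply, Fin.zero_eta, Fin.mk_one, Fin.reduceFinMk, cross_apply_zero,
      cross_apply_one, cross_apply_two] <;> fun_prop

/-- The `i`-th component of `v × B` does not involve `vᵢ`; hence the force is divergence free, term
by term. -/
lemma velPartial_lorentz (E B : Vec3) (i : Fin 3) (v : Vec3) :
    velPartial i (lorentz E B i) v = 0 := by
  rw [velPartial, ← (differentiable_lorentz E B i v).lineDeriv_eq_fderiv, lineDeriv]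
  have : (fun t : ℝ => lorentz E B i (v + t • EuclideanSpace.single i 1)) =
      fun _ => lorentz E B i v := by
    ext t
    unfold lorentz
    fin_cases i <;> simp [cross_apply_zero, cross_apply_one, cross_apply_two]
  rw [this, deriv_const]

lemma polyGrowth_lorentz (E B : Vec3) (i : Fin 3) :
    PolyGrowth (‖E‖ + 2 * ‖B‖) 1 (lorentz E B i) := by
  intro v
  have hc : ∀ a b c d : Fin 3, |E a + (v b * B c - v d * B b)| ≤ ‖E‖ + 2 * (‖v‖ * ‖B‖) := by
    intro a b c d
    have h1 : |v b * B c| ≤ ‖v‖ * ‖B‖ := by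
      rw [abs_mul]
      exact mul_le_mul (abs_coord_le _ _) (abs_coord_le _ _) (abs_nonneg _) (norm_nonneg _)
    have h2 : |v d * B b| ≤ ‖v‖ * ‖B‖ := by
      rw [abs_mul]
      exact mul_le_mul (abs_coord_le _ _) (abs_coord_le _ _) (abs_nonneg _) (norm_nonneg _)
    have h3 := abs_coord_le E a
    have h4 := abs_add_le (E a) (v b * B c - v d * B b)
    have h5 := abs_sub (v b * B c) (v d * B b)
    linarith
  have h : |lorentz E B i v| ≤ ‖E‖ + 2 * (‖v‖ * ‖B‖) := by
    unfold lorentz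
    fin_cases i <;>
      simp only [PiLp.add_apply, Fin.zero_eta, Fin.mk_one, Fin.reduceFinMk, cross_apply_zero,
        cross_apply_one, cross_apply_two] <;> exact hc _ _ _ _
  refine h.trans ?_
  have := norm_nonneg v
  have := norm_nonneg E
  have := norm_nonneg B
  rw [pow_one]
  nlinarith [mul_nonneg (norm_nonneg v) (norm_nonneg E)]

/-- The magnetic force does no work. -/
lemma sum_lorentz_mul_self (E B v : Vec3) :
    ∑ i, lorentz E B i v * v i = ∑ i, E i * v i := by
  simp only [lorentz, PiLp.add_apply, Fin.sum_univ_three, cross_apply_zero, cross_apply_one,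
    cross_apply_two]
  ring

namespace PositiveProfile

variable {D : ℕ → ℝ} {C : ℝ} {K : ℕ} {g : Vec3 → ℝ}

/-- `s log s - s` is a primitive of `log s`, so the tested force term is an exact derivative. -/
lemma velPartial_mul_log_sub (hg : PositiveProfile D C K g) (i : Fin 3) (v : Vec3) :
    velPartial i (fun v => Real.log (g v) * g v - g v) v =
      Real.log (g v) * velPartial i g v := by
  have h1 := hg.differentiable_log v
  have h2 := hg.differentiable v
  rw [velPartial_sub i (h1.fun_mul h2) h2, velPartial_mul i h1 h2, hg.velPartial_log,
    hg.partial_eq]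
  ring

lemma integrable_log_mul_force (hg : PositiveProfile D C K g) (E B : Vec3) (i : Fin 3) :
    Integrable fun v => lorentz E B i v * (Real.log (g v) * velPartial i g v) :=
  (((hg.decay_partial i).mul_poly hg.polyGrowth_log).mul_poly
    (polyGrowth_lorentz E B i)).integrable
    ((differentiable_lorentz E B i).continuous.measurable.mul
      (hg.differentiable_log.continuous.measurable.mul
        (measurable_velPartial i g))).aestronglyMeasurable

lemma integral_log_mul_force_component (hg : PositiveProfile D C K g) (E B : Vec3) (i : Fin 3) :
    ∫ v, lorentz E B i v * (Real.log (g v) * velPartial i g v) = 0 := by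
  have hF := differentiable_lorentz E B i
  have h1 := hg.differentiable_log
  have h2 := hg.differentiable
  have hφ : RapidDecay _ (fun v => Real.log (g v) * g v - g v) :=
    (hg.decay.mul_poly hg.polyGrowth_log).sub hg.decay
  have hFφ : Integrable fun v => lorentz E B i v * (Real.log (g v) * g v - g v) :=
    (hφ.mul_poly (polyGrowth_lorentz E B i)).integrable
      (hF.continuous.measurable.mul ((h1.continuous.measurable.mul
        h2.continuous.measurable).sub h2.continuous.measurable)).aestronglyMeasurable
  have hz : (fun v => fderiv ℝ (lorentz E B i) v (EuclideanSpace.single i 1) *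
      (Real.log (g v) * g v - g v)) = fun _ => 0 := by
    ext v
    have := velPartial_lorentz E B i v
    rw [velPartial] at this
    rw [this, zero_mul]
  have hp : (fun v => lorentz E B i v * fderiv ℝ (fun v => Real.log (g v) * g v - g v) v
      (EuclideanSpace.single i 1)) =
      fun v => lorentz E B i v * (Real.log (g v) * velPartial i g v) := by
    ext v
    rw [← hg.velPartial_mul_log_sub]
    rfl
  have h := integral_mul_fderiv_eq_neg_fderiv_mul_of_integrable (μ := volume)
    (f := lorentz E B i) (g := fun v => Real.log (g v) * g v - g v)
    (v := EuclideanSpace.single i 1) (by rw [hz]; exact integrable_zero _ _ _)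
    (by rw [hp]; exact hg.integrable_log_mul_force E B i) hFφ
    (fun v _ => hF v) (fun v _ => (h1.fun_mul h2).fun_sub h2 v)
  rw [hz, hp] at h
  simpa using h

/-- The Lorentz force does not change the entropy. -/
lemma integral_log_mul_force (hg : PositiveProfile D C K g) (E B : Vec3) :
    ∫ v, Real.log (g v) * ∑ i, lorentz E B i v * velPartial i g v = 0 := by
  have : ∀ v, Real.log (g v) * ∑ i, lorentz E B i v * velPartial i g v =
      ∑ i, lorentz E B i v * (Real.log (g v) * velPartial i g v) := fun v => by
    rw [Finset.mul_sum]
    exact Finset.sum_congr rfl fun i _ => by ring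
  simp only [this]
  rw [integral_finsetSum _ fun i _ => hg.integrable_log_mul_force E B i]
  simp [hg.integral_log_mul_force_component]

end PositiveProfile

/-! ### Local Maxwellians -/

/-- A vector field whose increments are collinear with increments of the variable is affine with
scalar linear part. -/
lemma exists_affine_of_collinear {s : Fin 3 → Vec3 → ℝ}
    (h : ∀ i j v w, (v i - w i) * (s j v - s j w) = (v j - w j) * (s i v - s i w)) :
    ∃ b : ℝ, ∀ i v, s i v = s i 0 + b * v i := by
  let e : Fin 3 → Vec3 := fun k => EuclideanSpace.single k 1
  have he : ∀ k j, e k j = if j = k then 1 else 0 := fun k j => by simp [e]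
  have h0 : ∀ i j v, v i * (s j v - s j 0) = v j * (s i v - s i 0) := by
    intro i j v
    simpa using h i j v 0
  have hek : ∀ k j, j ≠ k → s j (e k) = s j 0 := by
    intro k j hjk
    have := h0 k j (e k)
    simp [he, hjk] at this
    linarith
  -- Collinearity for the pairs `(v, e k)` and `(v, 0)`, subtracted: the unknown `s k v` cancels.
  -- The slope depends on `k` only, and `hb` shows that it is the same for every `k`.
  have key : ∀ k j v, j ≠ k → s j v - s j 0 = (s k (e k) - s k 0) * v j := by
    intro k j v hjk
    have h1 := h k j v (e k)
    have h2 := h0 k j v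
    rw [he, he, if_pos rfl, if_neg hjk, hek k j hjk] at h1
    linarith
  have hb : ∀ j k, j ≠ k → s j (e j) - s j 0 = s k (e k) - s k 0 := by
    intro j k hjk
    have := key k j (e j) hjk
    rwa [he, if_pos rfl, mul_one] at this
  refine ⟨s 0 (e 0) - s 0 0, fun i v => ?_⟩
  by_cases hi : i = 0
  · subst hi
    have := key 1 0 v (by decide)
    rw [hb 0 1 (by decide)]
    linarith
  · have := key 0 i v hi
    linarith

namespace PositiveProfile

variable {D : ℕ → ℝ} {C : ℝ} {K : ℕ} {g : Vec3 → ℝ}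

lemma log_eq_of_score_affine (hg : PositiveProfile D C K g) {a : Fin 3 → ℝ} {b : ℝ}
    (hs : ∀ i v, velScore g i v = a i + b * v i) (v : Vec3) :
    Real.log (g v) = Real.log (g 0) + ∑ i, a i * v i + b / 2 * ∑ i, v i ^ 2 := by
  let φ : ℝ → ℝ := fun t => Real.log (g (t • v)) -
    (t * ∑ i, a i * v i + t ^ 2 * (b / 2 * ∑ i, v i ^ 2))
  have hd : ∀ t, HasDerivAt φ 0 t := by
    intro t
    have h1 : HasDerivAt (fun t : ℝ => t • v) v t := by
      simpa using (hasDerivAt_id t).smul_const v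
    have h2 := (hg.differentiable_log (t • v)).hasFDerivAt.comp_hasDerivAt t h1
    rw [fderiv_eq_sum_velPartial] at h2
    simp only [hg.velPartial_log, hs] at h2
    have h3 : HasDerivAt (fun t : ℝ => t * ∑ i, a i * v i + t ^ 2 * (b / 2 * ∑ i, v i ^ 2))
        (1 * ∑ i, a i * v i + (2 * t) * (b / 2 * ∑ i, v i ^ 2)) t := by
      have h4 := ((hasDerivAt_id t).mul_const (∑ i, a i * v i)).fun_add
        ((hasDerivAt_pow 2 t).mul_const (b / 2 * ∑ i, v i ^ 2))
      simpa using h4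
    refine (h2.sub h3).congr_deriv ?_
    simp only [PiLp.smul_apply, smul_eq_mul, Fin.sum_univ_three]
    ring
  have hc := is_const_of_deriv_eq_zero (fun t => (hd t).differentiableAt)
    (fun t => (hd t).deriv) 1 0
  simp only [φ] at hc
  simp at hc
  linarith

/-- For `b ≥ 0` the mean of `log g` at `v` and `-v` is at least `log g(0)`, whereas decay puts both
values strictly below it far out. -/
lemma neg_of_score_affine (hg : PositiveProfile D C K g) {a : Fin 3 → ℝ} {b : ℝ}
    (hs : ∀ i v, velScore g i v = a i + b * v i) : b < 0 := by
  by_contra hb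
  push Not at hb
  have hlog := hg.log_eq_of_score_affine hs
  have hsum : ∀ v, 2 * Real.log (g 0) ≤ Real.log (g v) + Real.log (g (-v)) := by
    intro v
    rw [hlog v, hlog (-v)]
    simp only [PiLp.neg_apply, mul_neg, Finset.sum_neg_distrib, neg_sq]
    have : 0 ≤ b / 2 * ∑ i, v i ^ 2 := by positivity
    linarith
  have hg0 := hg.pos 0
  have hD := hg.decay.nonneg 1
  -- At this radius decay reads `(1 + t) g(v) ≤ D 1 = t g(0)`, hence `g(v) < g(0)`.
  let t : ℝ := D 1 / g 0
  have ht : 0 ≤ t := by positivity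
  have hlt : ∀ v : Vec3, ‖v‖ = t → Real.log (g v) < Real.log (g 0) := by
    intro v hv
    refine Real.log_lt_log (hg.pos v) ?_
    have h := hg.decay 1 v
    rw [abs_of_pos (hg.pos v), pow_one, hv] at h
    have h2 : t * g 0 = D 1 := div_mul_cancel₀ _ hg0.ne'
    by_contra hcon
    push Not at hcon
    nlinarith
  have hn : ‖(EuclideanSpace.single 0 t : Vec3)‖ = t := by simp [abs_of_nonneg ht]
  have := hsum (EuclideanSpace.single 0 t)
  have := hlt _ hn
  have := hlt _ ((norm_neg (EuclideanSpace.single 0 t : Vec3)).trans hn)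
  linarith

end PositiveProfile

/-! ### Calculus on the torus -/

/-- The covering map `ℝ³ → 𝕋³`. -/
def torusProj (y : Fin 3 → ℝ) : Torus3 := fun i => (y i : UnitAddCircle)

lemma periodicLift_apply (g : Torus3 → ℝ) (y : Fin 3 → ℝ) :
    periodicLift g y = g (torusProj y) := rfl

lemma isOpenQuotientMap_torusProj : IsOpenQuotientMap torusProj :=
  IsOpenQuotientMap.piMap fun _ => QuotientAddGroup.isOpenQuotientMap_mk

lemma torusProj_add_single (y : Fin 3 → ℝ) (i : Fin 3) (t : ℝ) :
    torusProj (y + t • Pi.single i 1) = torusProj y + Pi.single i (t : UnitAddCircle) := by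
  ext j
  by_cases h : j = i
  · subst h; simp [torusProj]
  · simp [torusProj, h]

lemma torusProj_add_int (y : Fin 3 → ℝ) (k : Fin 3 → ℤ) :
    torusProj (y + fun i => (k i : ℝ)) = torusProj y := by
  ext i
  simp [torusProj]

lemma continuous_of_periodicLift {g : Torus3 → ℝ} (hg : Continuous (periodicLift g)) :
    Continuous g :=
  isOpenQuotientMap_torusProj.isQuotientMap.continuous_iff.2 hg

lemma hasDerivAt_slice {g : Torus3 → ℝ} (hg : Differentiable ℝ (periodicLift g)) (i : Fin 3)
    (y : Fin 3 → ℝ) (s : ℝ) :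
    HasDerivAt (fun t : ℝ => g (torusProj y + Pi.single i (t : UnitAddCircle)))
      (fderiv ℝ (periodicLift g) (y + s • Pi.single i 1) (Pi.single i 1)) s := by
  have h1 : HasDerivAt (fun t : ℝ => y + t • (Pi.single i 1 : Fin 3 → ℝ)) (Pi.single i 1) s := by
    simpa using ((hasDerivAt_id s).smul_const (Pi.single i 1 : Fin 3 → ℝ)).const_add y
  have h2 := (hg _).hasFDerivAt.comp_hasDerivAt s h1
  refine h2.congr_of_eventuallyEq (Filter.Eventually.of_forall fun t => ?_)
  simp [periodicLift_apply, torusProj_add_single]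

lemma torusPartial_torusProj {g : Torus3 → ℝ} (hg : Differentiable ℝ (periodicLift g))
    (i : Fin 3) (y : Fin 3 → ℝ) :
    torusPartial i g (torusProj y) = fderiv ℝ (periodicLift g) y (Pi.single i 1) := by
  have h := (hasDerivAt_slice hg i y 0).deriv
  rw [zero_smul, add_zero] at h
  exact h

lemma periodicLift_torusPartial {g : Torus3 → ℝ} (hg : Differentiable ℝ (periodicLift g))
    (i : Fin 3) :
    periodicLift (torusPartial i g) =
      fun y => fderiv ℝ (periodicLift g) y (Pi.single i 1) :=
  funext fun y => torusPartial_torusProj hg i y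

lemma contDiff_torusPartial {g : Torus3 → ℝ} {n m : WithTop ℕ∞}
    (hg : ContDiff ℝ n (periodicLift g)) (hmn : m + 1 ≤ n) (i : Fin 3) :
    ContDiff ℝ m (periodicLift (torusPartial i g)) := by
  have hn : n ≠ 0 := by
    rintro rfl
    simp at hmn
  rw [periodicLift_torusPartial (hg.differentiable hn) i]
  exact (hg.fderiv_right hmn).clm_apply contDiff_const

lemma continuous_torusPartial {g : Torus3 → ℝ} (hg : ContDiff ℝ 1 (periodicLift g))
    (i : Fin 3) : Continuous (torusPartial i g) :=
  continuous_of_periodicLift (contDiff_torusPartial (m := 0) hg (by norm_num) i).continuous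

lemma hasDerivAt_torus {g : Torus3 → ℝ} (hg : Differentiable ℝ (periodicLift g)) (i : Fin 3)
    (x : Torus3) (s : ℝ) :
    HasDerivAt (fun t : ℝ => g (x + Pi.single i (t : UnitAddCircle)))
      (torusPartial i g (x + Pi.single i (s : UnitAddCircle))) s := by
  obtain ⟨y, rfl⟩ := isOpenQuotientMap_torusProj.surjective x
  rw [← torusProj_add_single, torusPartial_torusProj hg]
  exact hasDerivAt_slice hg i y s

lemma hasDerivAt_torus_zero {g : Torus3 → ℝ} (hg : Differentiable ℝ (periodicLift g))
    (i : Fin 3) (x : Torus3) :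
    HasDerivAt (fun t : ℝ => g (x + Pi.single i (t : UnitAddCircle))) (torusPartial i g x) 0 := by
  simpa using hasDerivAt_torus hg i x 0

lemma torusPartial_eq_of_hasDerivAt {g : Torus3 → ℝ} {i : Fin 3} {x : Torus3} {d : ℝ}
    (h : HasDerivAt (fun t : ℝ => g (x + Pi.single i (t : UnitAddCircle))) d 0) :
    torusPartial i g x = d := h.deriv

lemma torusPartial_mul {g h : Torus3 → ℝ} (hg : Differentiable ℝ (periodicLift g))
    (hh : Differentiable ℝ (periodicLift h)) (i : Fin 3) (x : Torus3) :
    torusPartial i (fun x => g x * h x) x =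
      torusPartial i g x * h x + g x * torusPartial i h x := by
  refine torusPartial_eq_of_hasDerivAt ?_
  simpa using (hasDerivAt_torus_zero hg i x).fun_mul (hasDerivAt_torus_zero hh i x)

lemma torusPartial_const_mul {g : Torus3 → ℝ} (hg : Differentiable ℝ (periodicLift g)) (c : ℝ)
    (i : Fin 3) (x : Torus3) :
    torusPartial i (fun x => c * g x) x = c * torusPartial i g x :=
  torusPartial_eq_of_hasDerivAt ((hasDerivAt_torus_zero hg i x).const_mul c)

lemma clm_apply_eq_sum (L : (Fin 3 → ℝ) →L[ℝ] ℝ) (u : Fin 3 → ℝ) :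
    L u = ∑ i, u i * L (Pi.single i 1) := by
  conv_lhs => rw [← Finset.univ_sum_single u]
  rw [map_sum]
  refine Finset.sum_congr rfl fun i _ => ?_
  have : (Pi.single i (u i) : Fin 3 → ℝ) = u i • Pi.single i 1 := by
    rw [← Pi.single_smul]; simp
  rw [this, map_smul, smul_eq_mul]

lemma torus_const_of_partial_eq_zero {g : Torus3 → ℝ} (hg : Differentiable ℝ (periodicLift g))
    (h : ∀ i x, torusPartial i g x = 0) (x y : Torus3) : g x = g y := by
  obtain ⟨x, rfl⟩ := isOpenQuotientMap_torusProj.surjective x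
  obtain ⟨y, rfl⟩ := isOpenQuotientMap_torusProj.surjective y
  refine is_const_of_fderiv_eq_zero (𝕜 := ℝ) hg (fun z => ?_) x y
  ext u
  rw [clm_apply_eq_sum]
  simp [← torusPartial_torusProj hg, h]

lemma torus_bounded_of_continuous {g : Torus3 → ℝ} (hg : Continuous g) :
    ∃ M, ∀ x, |g x| ≤ M := by
  obtain ⟨M, hM⟩ := isCompact_univ.exists_bound_of_continuousOn hg.continuousOn
  exact ⟨M, fun x => hM x trivial⟩

lemma torus_integrable_of_continuous {g : Torus3 → ℝ} (hg : Continuous g) : Integrable g := by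
  obtain ⟨M, hM⟩ := torus_bounded_of_continuous hg
  exact Integrable.of_bound hg.aestronglyMeasurable M (Filter.Eventually.of_forall hM)

/-- The integral of a partial derivative over the torus vanishes. -/
lemma integral_torusPartial {g : Torus3 → ℝ} (hg : ContDiff ℝ 1 (periodicLift g)) (i : Fin 3) :
    ∫ x, torusPartial i g x = 0 := by
  have hc := continuous_of_periodicLift hg.continuous
  have hc' := continuous_torusPartial hg i
  obtain ⟨M, hM⟩ := torus_bounded_of_continuous hc'
  have hs : ∀ t : ℝ, Continuous fun x : Torus3 => x + Pi.single i (t : UnitAddCircle) :=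
    fun t => continuous_id.add continuous_const
  let F : ℝ → Torus3 → ℝ := fun t x => g (x + Pi.single i (t : UnitAddCircle))
  let F' : ℝ → Torus3 → ℝ := fun t x => torusPartial i g (x + Pi.single i (t : UnitAddCircle))
  have hF : ∀ t, Continuous (F t) := fun t => hc.comp (hs t)
  have hF' : ∀ t, Continuous (F' t) := fun t => hc'.comp (hs t)
  have hFd : ∀ x t, HasDerivAt (fun t => F t x) (F' t x) t := fun x t =>
    hasDerivAt_torus (hg.differentiable (by simp)) i x t
  have hb : ∀ x t, ‖F' t x‖ ≤ M := fun x t => hM _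
  -- The integral of the translate of `g` by `t` in direction `i` is independent of `t`; its
  -- derivative at 0 is the integral in question.
  have h := hasDerivAt_integral_of_dominated_loc_of_deriv_le (μ := (volume : Measure Torus3))
    (F := F) (F' := F') (x₀ := 0) (s := Set.univ) (bound := fun _ => M) Filter.univ_mem
    (Filter.Eventually.of_forall fun t => (hF t).aestronglyMeasurable)
    (torus_integrable_of_continuous (hF 0)) (hF' 0).aestronglyMeasurable
    (Filter.Eventually.of_forall fun x t _ => hb x t) (integrable_const M)
    (Filter.Eventually.of_forall fun x t _ => hFd x t)
  have h2 := h.2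
  have h3 : (fun t : ℝ => ∫ x, F t x) =
      fun _ => ∫ x, g x :=
    funext fun t => integral_add_right_eq_self (μ := (volume : Measure Torus3)) g _
  have h4 : ∫ x, F' 0 x =
     ∫ x, torusPartial i g x :=
    integral_add_right_eq_self (μ := (volume : Measure Torus3)) (torusPartial i g) _
  rw [h3, h4] at h2
  exact h2.unique (hasDerivAt_const _ _)

lemma torusPartial_comm {g : Torus3 → ℝ} (hg : ContDiff ℝ 2 (periodicLift g)) (i j : Fin 3)
    (x : Torus3) :
    torusPartial i (torusPartial j g) x = torusPartial j (torusPartial i g) x := by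
  obtain ⟨y, rfl⟩ := isOpenQuotientMap_torusProj.surjective x
  have hd : Differentiable ℝ (periodicLift g) := hg.differentiable (by simp)
  have hd' : ∀ k, Differentiable ℝ (periodicLift (torusPartial k g)) := fun k =>
    (contDiff_torusPartial (m := 1) hg (by norm_num) k).differentiable (by simp)
  have hdf : Differentiable ℝ (fderiv ℝ (periodicLift g)) :=
    (hg.fderiv_right (m := 1) (by norm_num)).differentiable (by simp)
  rw [torusPartial_torusProj (hd' j), torusPartial_torusProj (hd' i),
    periodicLift_torusPartial hd, periodicLift_torusPartial hd]
  have hs : IsSymmSndFDerivAt ℝ (periodicLift g) y :=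
    hg.contDiffAt.isSymmSndFDerivAt (by simp)
  rw [fderiv_clm_apply (hdf y) (differentiableAt_const _),
    fderiv_clm_apply (hdf y) (differentiableAt_const _)]
  simpa using hs.eq (Pi.single i 1) (Pi.single j 1)

/-- Harmonic functions on the torus are constant. -/
lemma torus_const_of_laplacian_eq_zero {g : Torus3 → ℝ} (hg : ContDiff ℝ 2 (periodicLift g))
    (h : ∀ x, ∑ i, torusPartial i (torusPartial i g) x = 0) (x y : Torus3) : g x = g y := by
  have hg1 : ContDiff ℝ 1 (periodicLift g) := hg.of_le (by norm_num)
  have hd : Differentiable ℝ (periodicLift g) := hg.differentiable (by simp)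
  have hg' : ∀ i, ContDiff ℝ 1 (periodicLift (torusPartial i g)) := fun i =>
    contDiff_torusPartial hg (by norm_num) i
  have hd' : ∀ i, Differentiable ℝ (periodicLift (torusPartial i g)) := fun i =>
    (hg' i).differentiable (by simp)
  -- Energy method: the divergence of `g ∇g` integrates to zero, and for harmonic `g` it equals
  -- `|∇g|²`.
  have hz : ∫ x, ∑ i, torusPartial i (fun x => g x * torusPartial i g x) x = 0 := by
    have hp : ∀ i, ContDiff ℝ 1 (periodicLift fun x => g x * torusPartial i g x) := fun i =>
      hg1.mul (hg' i)
    rw [integral_finsetSum _ fun i _ =>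
      torus_integrable_of_continuous (continuous_torusPartial (hp i) i)]
    simp [integral_torusPartial (hp _)]
  have he : ∀ x, ∑ i, torusPartial i (fun x => g x * torusPartial i g x) x =
      ∑ i, torusPartial i g x ^ 2 := by
    intro x
    simp only [torusPartial_mul hd (hd' _), Finset.sum_add_distrib, ← Finset.mul_sum, h]
    simp [sq]
  simp only [he] at hz
  have hcont : Continuous fun x => ∑ i, torusPartial i g x ^ 2 :=
    continuous_finsetSum _ fun i _ => (continuous_torusPartial hg1 i).pow 2
  have hz' := (integral_eq_zero_iff_of_nonneg
    (fun x => Finset.sum_nonneg fun i _ => sq_nonneg _)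
    (torus_integrable_of_continuous hcont)).1 hz
  have hz'' := (hcont.ae_eq_iff_eq _ continuous_const).1 hz'
  refine torus_const_of_partial_eq_zero hd (fun i x => ?_) x y
  have h0 := congrFun hz'' x
  have h1 := (Finset.sum_eq_zero_iff_of_nonneg fun i _ => sq_nonneg _).1 h0 i (Finset.mem_univ i)
  exact pow_eq_zero_iff two_ne_zero |>.1 h1

/-- A continuous nonnegative function with zero integral vanishes. -/
lemma torus_eq_zero_of_nonneg {h : Torus3 → ℝ} (hc : Continuous h) (h0 : ∀ x, 0 ≤ h x)
    (hint : ∫ x, h x = 0) (x : Torus3) : h x = 0 := by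
  have h1 := (integral_eq_zero_iff_of_nonneg h0 (torus_integrable_of_continuous hc)).1 hint
  exact congrFun ((hc.ae_eq_iff_eq _ continuous_const).1 h1) x

/-- At a maximum point the pure second derivatives are nonpositive. -/
lemma torusPartial_torusPartial_nonpos {g : Torus3 → ℝ} (hg : ContDiff ℝ 2 (periodicLift g))
    {x : Torus3} (hx : ∀ y, g y ≤ g x) (i : Fin 3) :
    torusPartial i (torusPartial i g) x ≤ 0 := by
  by_contra hcon
  push Not at hcon
  have hd : Differentiable ℝ (periodicLift g) := hg.differentiable (by simp)
  have hd' : Differentiable ℝ (periodicLift (torusPartial i g)) :=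
    (contDiff_torusPartial (m := 1) hg (by norm_num) i).differentiable (by simp)
  let φ : ℝ → ℝ := fun t => g (x + Pi.single i (t : UnitAddCircle))
  have hφ : ∀ t : ℝ, HasDerivAt φ (torusPartial i g (x + Pi.single i (t : UnitAddCircle))) t :=
    hasDerivAt_torus hd i x
  have hφ' : deriv φ = fun t : ℝ => torusPartial i g (x + Pi.single i (t : UnitAddCircle)) :=
    funext fun t => (hφ t).deriv
  have hφ'' : deriv (deriv φ) 0 = torusPartial i (torusPartial i g) x := by
    rw [hφ']
    exact (hasDerivAt_torus_zero hd' i x).deriv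
  have hmax : IsLocalMax φ 0 := Filter.Eventually.of_forall fun t => by
    simpa [φ] using hx _
  -- A positive second derivative makes the maximum also a local minimum, so `φ` is locally constant
  -- and its second derivative is zero.
  have hmin : IsLocalMin φ 0 :=
    isLocalMin_of_deriv_deriv_pos (by rw [hφ'']; exact hcon) hmax.deriv_eq_zero
      (hφ 0).continuousAt
  have hconst : φ =ᶠ[nhds 0] fun _ => φ 0 := by
    filter_upwards [hmax, hmin] with t h1 h2
    exact le_antisymm h1 h2
  have h3 : deriv (deriv φ) 0 = 0 := by
    rw [hconst.deriv.deriv_eq]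
    simp
  rw [← hφ'', h3] at hcon
  exact lt_irrefl _ hcon

/-! ### Families of profiles over the torus -/

/-- The error depends on the profile only through `D`, so across a family it is uniform in the
parameter. -/
lemma VelocityProfile.abs_difference_quotient_sub_le {D : ℕ → ℝ} {g : Vec3 → ℝ}
    (hg : VelocityProfile D g) (i : Fin 3) (v : Vec3) {h : ℝ} (hh : 0 < h) :
    |h⁻¹ * (g (v + h • EuclideanSpace.single i 1) - g v) - velPartial i g v| ≤ D 0 * h := by
  let e : Vec3 := EuclideanSpace.single i 1
  have hline : ∀ t : ℝ, HasDerivAt (fun t : ℝ => v + t • e) e t := fun t => by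
    simpa using ((hasDerivAt_id t).smul_const e).const_add v
  have h1 : ∀ t : ℝ, HasDerivAt (fun t : ℝ => g (v + t • e)) (velPartial i g (v + t • e)) t :=
    fun t => (hg.differentiable _).hasFDerivAt.comp_hasDerivAt t (hline t)
  have h2 : ∀ t : ℝ, HasDerivAt (fun t : ℝ => velPartial i g (v + t • e))
      (velPartial i (velPartial i g) (v + t • e)) t :=
    fun t => (hg.differentiable_partial i _).hasFDerivAt.comp_hasDerivAt t (hline t)
  have hb2 : ∀ u, ‖velPartial i (velPartial i g) u‖ ≤ D 0 := fun u => by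
    simpa using hg.decay_partial₂ i i 0 u
  have hD : 0 ≤ D 0 := hg.decay.nonneg 0
  have h3 : ∀ t ∈ Set.Icc (0 : ℝ) h,
      ‖velPartial i g (v + t • e) - velPartial i g v‖ ≤ D 0 * h := by
    intro t ht
    have := (convex_Icc (0 : ℝ) h).norm_image_sub_le_of_norm_hasDerivWithin_le
      (fun s _ => (h2 s).hasDerivWithinAt) (fun s _ => hb2 _) (x := 0) (y := t)
      ⟨le_rfl, hh.le⟩ ht
    simp only [zero_smul, add_zero, sub_zero] at this
    refine this.trans ?_
    rw [Real.norm_of_nonneg ht.1]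
    exact mul_le_mul_of_nonneg_left ht.2 hD
  have h4 : ∀ t : ℝ, HasDerivAt (fun t : ℝ => g (v + t • e) - t * velPartial i g v)
      (velPartial i g (v + t • e) - velPartial i g v) t := fun t => by
    simpa using (h1 t).fun_sub ((hasDerivAt_id t).mul_const (velPartial i g v))
  have h5 := (convex_Icc (0 : ℝ) h).norm_image_sub_le_of_norm_hasDerivWithin_le
    (fun s _ => (h4 s).hasDerivWithinAt) h3 (x := 0) (y := h) ⟨le_rfl, hh.le⟩ ⟨hh.le, le_rfl⟩
  simp only [zero_smul, add_zero, sub_zero, zero_mul, Real.norm_of_nonneg hh.le,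
    Real.norm_eq_abs] at h5
  have h6 : h⁻¹ * (g (v + h • e) - g v) - velPartial i g v =
      h⁻¹ * (g (v + h • e) - h * velPartial i g v - g v) := by
    field_simp
    ring
  rw [h6, abs_mul, abs_of_pos (inv_pos.2 hh), inv_mul_le_iff₀ hh]
  linarith

/-- Velocity derivatives depend continuously on a parameter. -/
lemma continuous_velPartial_param {X : Type*} [TopologicalSpace X] {D : ℕ → ℝ}
    {f : X → Vec3 → ℝ} (hf : ∀ x, VelocityProfile D (f x))
    (hc : ∀ v, Continuous fun x => f x v) (i : Fin 3) (v : Vec3) :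
    Continuous fun x => velPartial i (f x) v := by
  -- Difference quotients in `v` are continuous in the parameter and converge uniformly.
  refine continuous_of_uniform_approx_of_continuous fun u hu => ?_
  obtain ⟨ε, hε, hu⟩ := Metric.mem_uniformity_dist.1 hu
  have hD : 0 < |D 0| + 1 := by positivity
  let h : ℝ := ε / (|D 0| + 1) / 2
  have hh : 0 < h := by positivity
  refine ⟨fun x => h⁻¹ * (f x (v + h • EuclideanSpace.single i 1) - f x v),
    continuous_const.mul ((hc _).sub (hc _)), fun x => hu ?_⟩
  rw [dist_comm, Real.dist_eq]
  refine ((hf x).abs_difference_quotient_sub_le i v hh).trans_lt ?_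
  calc D 0 * h ≤ (|D 0| + 1) * h := by
        gcongr
        linarith [le_abs_self (D 0)]
    _ = ε / 2 := by simp only [h]; field_simp
    _ < ε := half_lt_self hε

/-- A positive decaying profile is not constant along lines. -/
lemma VelocityProfile.exists_fderiv_ne_zero {D : ℕ → ℝ} {g : Vec3 → ℝ}
    (hg : VelocityProfile D g) (hpos : ∀ v, 0 < g v) {e : Vec3} (he : ‖e‖ = 1) :
    ∃ v, fderiv ℝ g v e ≠ 0 := by
  by_contra hcon
  push Not at hcon
  have hline : ∀ t : ℝ, HasDerivAt (fun t : ℝ => t • e) e t := fun t => by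
    simpa using (hasDerivAt_id t).smul_const e
  have h1 : ∀ t : ℝ, HasDerivAt (fun t : ℝ => g (t • e)) 0 t := fun t => by
    have := (hg.differentiable (t • e)).hasFDerivAt.comp_hasDerivAt t (hline t)
    rwa [hcon] at this
  have hD := hg.decay.nonneg 1
  have h0 := hpos 0
  -- At distance `t = D 1 / g 0` along the line, constancy and decay give `(1 + t) g(0) ≤ t g(0)`,
  -- which is absurd.
  have h2 := is_const_of_deriv_eq_zero (fun t => (h1 t).differentiableAt)
    (fun t => (h1 t).deriv) (D 1 / g 0) 0
  simp only [zero_smul] at h2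
  have h3 := hg.decay 1 ((D 1 / g 0) • e)
  rw [h2, abs_of_pos h0, norm_smul, he, mul_one, pow_one,
    Real.norm_of_nonneg (by positivity)] at h3
  have h4 : D 1 / g 0 * g 0 = D 1 := div_mul_cancel₀ _ h0.ne'
  nlinarith

/-- A field is bounded as soon as, for each velocity, its work against the velocity gradient of
the distribution is bounded. -/
lemma bounded_of_force_bounded {f : Torus3 → Vec3 → ℝ} {D : ℕ → ℝ}
    (hf : ∀ x, VelocityProfile D (f x)) (hpos : ∀ x v, 0 < f x v)
    (hc : ∀ v, Continuous fun x => f x v) {E : Torus3 → Vec3}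
    (hE : ∀ v, ∃ M, ∀ x, |∑ i, E x i * velPartial i (f x) v| ≤ M) :
    ∃ M, ∀ x, ‖E x‖ ≤ M := by
  by_contra hcon
  push Not at hcon
  choose x hx using fun n : ℕ => hcon (n + 1)
  have hpos' : ∀ n, 0 < ‖E (x n)‖ := fun n => by
    have : (0 : ℝ) ≤ n := n.cast_nonneg
    linarith [hx n]
  -- If `E` were unbounded, its directions would accumulate at a unit vector `e₀` over some `x₀`.
  -- Dividing the bounded work by `‖E‖` shows that `f x₀` has zero derivative along `e₀`, against
  -- `exists_fderiv_ne_zero`.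
  let e : ℕ → Vec3 := fun n => ‖E (x n)‖⁻¹ • E (x n)
  have hen : ∀ n, e n ∈ Metric.sphere (0 : Vec3) 1 := fun n => by
    simp [e, norm_smul, (hpos' n).ne']
  have hcomp : IsCompact ((Set.univ : Set Torus3) ×ˢ Metric.sphere (0 : Vec3) 1) :=
    isCompact_univ.prod (isCompact_sphere _ _)
  obtain ⟨⟨x₀, e₀⟩, hmem, φ, hφ, hlim⟩ := hcomp.tendsto_subseq
    (x := fun n => (x n, e n)) fun n => ⟨trivial, hen n⟩
  have he₀ : ‖e₀‖ = 1 := by simpa using hmem.2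
  obtain ⟨v, hv⟩ := (hf x₀).exists_fderiv_ne_zero (hpos x₀) he₀
  apply hv
  rw [fderiv_eq_sum_velPartial]
  have hx₀ : Tendsto (fun n => x (φ n)) atTop (𝓝 x₀) := (continuous_fst.tendsto _).comp hlim
  have he : Tendsto (fun n => e (φ n)) atTop (𝓝 e₀) := (continuous_snd.tendsto _).comp hlim
  have h1 : Tendsto (fun n => ∑ i, e (φ n) i * velPartial i (f (x (φ n))) v) atTop
      (𝓝 (∑ i, e₀ i * velPartial i (f x₀) v)) := by
    refine tendsto_finsetSum _ fun i _ => Tendsto.mul ?_ ?_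
    · exact ((differentiable_coord i).continuous.tendsto _).comp he
    · exact ((continuous_velPartial_param hf hc i v).tendsto _).comp hx₀
  obtain ⟨M, hM⟩ := hE v
  have h2 : Tendsto (fun n => ∑ i, e (φ n) i * velPartial i (f (x (φ n))) v) atTop (𝓝 0) := by
    have hinv : Tendsto (fun n : ℕ => M * (1 / ((n : ℝ) + 1))) atTop (𝓝 0) := by
      simpa using tendsto_one_div_add_atTop_nhds_zero_nat.const_mul M
    refine squeeze_zero_norm (fun n => ?_) (hinv.comp hφ.tendsto_atTop)
    have heq : ∑ i, e (φ n) i * velPartial i (f (x (φ n))) v =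
        ‖E (x (φ n))‖⁻¹ * ∑ i, E (x (φ n)) i * velPartial i (f (x (φ n))) v := by
      rw [Finset.mul_sum]
      exact Finset.sum_congr rfl fun i _ => by simp [e, mul_assoc]
    have hM0 : 0 ≤ M := (abs_nonneg _).trans (hM x₀)
    rw [heq, norm_mul, norm_inv, norm_norm, Real.norm_eq_abs, mul_comm]
    have hn : (0 : ℝ) < (φ n : ℝ) + 1 := by positivity
    simp only [Function.comp_apply]
    rw [one_div]
    have := hx (φ n)
    gcongr
    exact hM _
  exact tendsto_nhds_unique h1 h2

/-! ### Transport entropy: measurability and Fubini on phase space -/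

/-- The free transport term `v · ∇ₓ f`. -/
def transport (f : Torus3 → Vec3 → ℝ) (x : Torus3) (v : Vec3) : ℝ :=
  ∑ i, v i * torusPartial i (fun y => f y v) x

/-- A Carathéodory function: continuous in `x`, and measurable in `v` as a limit of difference
quotients in `x`. Separate regularity of `f` is enough. -/
lemma measurable_uncurry_torusPartial {f : Torus3 → Vec3 → ℝ}
    (hx : ∀ v, ContDiff ℝ 1 (periodicLift fun x => f x v)) (hv : ∀ x, Continuous (f x))
    (i : Fin 3) :
    Measurable fun p : Torus3 × Vec3 => torusPartial i (fun y => f y p.2) p.1 := by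
  have hs : ∀ x, Measurable fun v => torusPartial i (fun y => f y v) x := by
    intro x
    have hseq : Tendsto (fun n : ℕ => 1 / ((n : ℝ) + 1)) atTop (𝓝[≠] 0) :=
      tendsto_nhdsWithin_iff.2 ⟨tendsto_one_div_add_atTop_nhds_zero_nat,
        Eventually.of_forall fun n => by
          have : (0 : ℝ) < 1 / ((n : ℝ) + 1) := by positivity
          exact this.ne'⟩
    refine measurable_of_tendsto_metrizable (f := fun (n : ℕ) v => (1 / ((n : ℝ) + 1))⁻¹ *
      (f (x + Pi.single i ((1 / ((n : ℝ) + 1) : ℝ) : UnitAddCircle)) v - f x v))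
      (fun n => ?_) ?_
    · exact (((hv _).sub (hv _)).measurable).const_mul _
    · rw [tendsto_pi_nhds]
      intro v
      have hd := hasDerivAt_torus_zero ((hx v).differentiable (by simp)) i x
      have := (hasDerivAt_iff_tendsto_slope.1 hd).comp hseq
      simpa [slope_def_field, Function.comp_def, div_eq_inv_mul] using this
  have h := measurable_uncurry_of_continuous_of_measurable
    (u := fun (x : Torus3) (v : Vec3) => torusPartial i (fun y => f y v) x)
    (fun v => continuous_torusPartial (hx v) i) hs
  exact h

lemma measurable_uncurry_torus {f : Torus3 → Vec3 → ℝ}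
    (hx : ∀ v, Continuous fun x => f x v) (hv : ∀ x, Continuous (f x)) :
    Measurable fun p : Torus3 × Vec3 => f p.1 p.2 :=
  measurable_uncurry_of_continuous_of_measurable (u := f) hx fun x => (hv x).measurable

/-- Free transport preserves the entropy at each fixed velocity. -/
lemma integral_log_mul_transport {f : Torus3 → Vec3 → ℝ} (hpos : ∀ x v, 0 < f x v)
    (hx : ∀ v, ContDiff ℝ 1 (periodicLift fun x => f x v)) (v : Vec3) :
    ∫ x, Real.log (f x v) * transport f x v = 0 := by
  have hlog : ContDiff ℝ 1 (periodicLift fun x => Real.log (f x v)) :=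
    (hx v).log fun y => (hpos _ v).ne'
  have hh : ContDiff ℝ 1 (periodicLift fun x => Real.log (f x v) * f x v - f x v) :=
    (hlog.mul (hx v)).sub (hx v)
  have hp : ∀ i x, torusPartial i (fun x => Real.log (f x v) * f x v - f x v) x =
      Real.log (f x v) * torusPartial i (fun x => f x v) x := by
    intro i x
    have h1 := hasDerivAt_torus_zero ((hx v).differentiable (by simp)) i x
    have hne : f (x + Pi.single i ((0 : ℝ) : UnitAddCircle)) v ≠ 0 := (hpos _ v).ne'
    have h2 := h1.log hne
    refine (torusPartial_eq_of_hasDerivAt ((h2.fun_mul h1).fun_sub h1)).trans ?_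
    have hne' := (hpos x v).ne'
    simp only [AddCircle.coe_zero, Pi.single_zero, add_zero]
    field_simp
    ring
  have he : ∀ x, Real.log (f x v) * transport f x v =
      ∑ i, v i * torusPartial i (fun x => Real.log (f x v) * f x v - f x v) x := by
    intro x
    rw [transport, Finset.mul_sum]
    refine Finset.sum_congr rfl fun i _ => ?_
    rw [hp]
    ring
  simp only [he]
  rw [integral_finsetSum _ fun i _ =>
    (torus_integrable_of_continuous (continuous_torusPartial hh i)).const_mul _]
  simp [integral_const_mul, integral_torusPartial hh]

/-- If the transport term decays uniformly and its entropy production is nonpositive at every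
point, then it vanishes almost everywhere. -/
lemma ae_integral_log_mul_transport_eq_zero {f : Torus3 → Vec3 → ℝ} (hpos : ∀ x v, 0 < f x v)
    (hx : ∀ v, ContDiff ℝ 1 (periodicLift fun x => f x v)) (hv : ∀ x, Continuous (f x))
    {D' : ℕ → ℝ} (hT : ∀ x, RapidDecay D' fun v => Real.log (f x v) * transport f x v)
    (hneg : ∀ x, ∫ v, Real.log (f x v) * transport f x v ≤ 0) :
    ∀ᵐ x, ∫ v, Real.log (f x v) * transport f x v = 0 := by
  have hm : Measurable fun p : Torus3 × Vec3 => Real.log (f p.1 p.2) * transport f p.1 p.2 := by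
    refine (Real.measurable_log.comp
      (measurable_uncurry_torus (fun v => continuous_of_periodicLift (hx v).continuous) hv)).mul ?_
    unfold transport
    refine Finset.measurable_sum _ fun i _ => Measurable.mul ?_
      (measurable_uncurry_torusPartial hx hv i)
    exact (differentiable_coord i).continuous.measurable.comp measurable_snd
  have hint : Integrable (fun p : Torus3 × Vec3 => Real.log (f p.1 p.2) * transport f p.1 p.2)
      ((volume : Measure Torus3).prod volume) := by
    have hw : Integrable (fun p : Torus3 × Vec3 => (D' 4 : ℝ) * ((1 + ‖p.2‖) ^ 4)⁻¹)
        ((volume : Measure Torus3).prod volume) :=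
      (integrable_const (D' 4)).mul_prod (integrable_decayWeight le_rfl)
    exact hw.mono' hm.aestronglyMeasurable
      (Eventually.of_forall fun p => (hT p.1).le_inv 4 p.2)
  -- Integrating in `x` first gives zero at each `v`; a nonpositive function of `x` with zero
  -- integral then vanishes almost everywhere.
  have hzero : ∫ x, ∫ v, Real.log (f x v) * transport f x v = 0 := by
    rw [integral_integral_swap (f := fun x v => Real.log (f x v) * transport f x v) hint]
    simp [integral_log_mul_transport hpos hx]
  have hneg' : 0 ≤ᵐ[(volume : Measure Torus3)]
      fun x => -∫ v, Real.log (f x v) * transport f x v :=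
    Eventually.of_forall fun x => neg_nonneg.2 (hneg x)
  have hi : Integrable fun x => -∫ v, Real.log (f x v) * transport f x v :=
    hint.integral_prod_left.neg
  have h0 := (integral_eq_zero_iff_of_nonneg_ae hneg' hi).1 (by rw [integral_neg, hzero, neg_zero])
  filter_upwards [h0] with x hx
  simpa using hx

/-! ### Steady states -/

lemma abs_velPartial_velPartial_le {g : Vec3 → ℝ} (hg : ContDiff ℝ 2 g) (i j : Fin 3)
    (v : Vec3) : |velPartial i (velPartial j g) v| ≤ ‖iteratedFDeriv ℝ 2 g v‖ := by
  have hd : Differentiable ℝ (fderiv ℝ g) :=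
    (hg.fderiv_right (m := 1) (by norm_num)).differentiable (by simp)
  have h1 : velPartial i (velPartial j g) v =
      fderiv ℝ (fderiv ℝ g) v (EuclideanSpace.single i 1) (EuclideanSpace.single j 1) := by
    change fderiv ℝ (fun u => fderiv ℝ g u (EuclideanSpace.single j 1)) v _ = _
    rw [fderiv_clm_apply (hd v) (differentiableAt_const _)]
    simp
  have h2 : ‖iteratedFDeriv ℝ 2 g v‖ = ‖fderiv ℝ (fderiv ℝ g) v‖ := by
    rw [← norm_iteratedFDeriv_fderiv, norm_iteratedFDeriv_one]
  rw [h1, h2, ← Real.norm_eq_abs]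
  refine (ContinuousLinearMap.le_opNorm₂ _ _ _).trans_eq ?_
  simp

lemma UniformSchwartzDecay.exists_velocityProfile {f : Torus3 → Vec3 → ℝ}
    (hf : UniformSchwartzDecay f) (hv : ∀ x, ContDiff ℝ 3 (f x)) :
    ∃ D, ∀ x, VelocityProfile D (f x) := by
  choose C₀ hC₀ using hf 0 (by norm_num)
  choose C₁ hC₁ using hf 1 (by norm_num)
  choose C₂ hC₂ using hf 2 (by norm_num)
  have h0 : ∀ N, 0 ≤ C₀ N := fun N => le_trans (by positivity) (hC₀ N 0 0)
  have h1 : ∀ N, 0 ≤ C₁ N := fun N => le_trans (by positivity) (hC₁ N 0 0)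
  have h2 : ∀ N, 0 ≤ C₂ N := fun N => le_trans (by positivity) (hC₂ N 0 0)
  refine ⟨fun N => C₀ N + C₁ N + C₂ N, fun x => ⟨(hv x).of_le (by norm_num), ?_, ?_, ?_⟩⟩
  · intro N v
    have := hC₀ N x v
    rw [norm_iteratedFDeriv_zero, Real.norm_eq_abs] at this
    linarith [h1 N, h2 N]
  · intro i N v
    have := hC₁ N x v
    rw [norm_iteratedFDeriv_one] at this
    have h3 : (1 + ‖v‖) ^ N * |velPartial i (f x) v| ≤ (1 + ‖v‖) ^ N * ‖fderiv ℝ (f x) v‖ := by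
      gcongr
      exact abs_velPartial_le i _ v
    linarith [h0 N, h2 N]
  · intro i j N v
    have := hC₂ N x v
    have h3 : (1 + ‖v‖) ^ N * |velPartial i (velPartial j (f x)) v| ≤
        (1 + ‖v‖) ^ N * ‖iteratedFDeriv ℝ 2 (f x) v‖ := by
      gcongr
      exact abs_velPartial_velPartial_le ((hv x).of_le (by norm_num)) i j v
    linarith [h0 N, h1 N]

lemma torus_vec_bounded {B : Torus3 → Vec3} (hB : ∀ i, Continuous fun x => B x i) :
    ∃ M, ∀ x, ‖B x‖ ≤ M := by
  choose M hM using fun i => torus_bounded_of_continuous (hB i)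
  refine ⟨∑ i, M i, fun x => ?_⟩
  calc ‖B x‖ = ‖∑ i, B x i • EuclideanSpace.single i (1 : ℝ)‖ := by rw [← vec_eq_sum]
    _ ≤ ∑ i, ‖B x i • EuclideanSpace.single i (1 : ℝ)‖ := norm_sum_le _ _
    _ ≤ ∑ i, M i := Finset.sum_le_sum fun i _ => by simpa [norm_smul] using hM i x

/-- Steady states of the Vlasov–Maxwell–Landau system whose velocity profiles satisfy uniform
bounds. -/
structure IsSteadyState (ν ρ_ion : ℝ) (D : ℕ → ℝ) (C : ℝ) (K : ℕ) (f : Torus3 → Vec3 → ℝ)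
    (E B : Torus3 → Vec3) : Prop where
  ν_pos : 0 < ν
  profile : ∀ x, PositiveProfile D C K (f x)
  smooth_x : ∀ v, ContDiff ℝ 2 (periodicLift (fun x => f x v))
  smooth_B : ∀ i, ContDiff ℝ 2 (periodicLift (fun x => B x i))
  vlasov : ∀ x v, transport f x v + ∑ i, lorentz (E x) (B x) i v * velPartial i (f x) v =
    ν * landauOperator coulombKernel (f x) v
  ampere : ∀ x i, torusCurl B x i = ∫ v, v i * f x v
  gauss : ∀ x, torusDiv E x = (∫ v, f x v) - ρ_ion
  divB : ∀ x, torusDiv B x = 0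

namespace IsSteadyState

variable {ν ρ_ion : ℝ} {D : ℕ → ℝ} {C : ℝ} {K : ℕ} {f : Torus3 → Vec3 → ℝ}
  {E B : Torus3 → Vec3}

lemma smooth_x_one (h : IsSteadyState ν ρ_ion D C K f E B) (v : Vec3) :
    ContDiff ℝ 1 (periodicLift (fun x => f x v)) := (h.smooth_x v).of_le (by norm_num)

lemma continuous_x (h : IsSteadyState ν ρ_ion D C K f E B) (v : Vec3) :
    Continuous fun x => f x v := continuous_of_periodicLift (h.smooth_x v).continuous

lemma continuous_B (h : IsSteadyState ν ρ_ion D C K f E B) (i : Fin 3) :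
    Continuous fun x => B x i := continuous_of_periodicLift (h.smooth_B i).continuous

/-- Solving the Vlasov equation for `E · ∇ᵥ f` leaves terms that are bounded in `x` at each fixed
`v`, which is what `bounded_of_force_bounded` requires. -/
lemma bounded_E (h : IsSteadyState ν ρ_ion D C K f E B) : ∃ M, ∀ x, ‖E x‖ ≤ M := by
  refine bounded_of_force_bounded (fun x => (h.profile x).toVelocityProfile)
    (fun x => (h.profile x).pos) h.continuous_x fun v => ?_
  obtain ⟨MB, hMB⟩ := torus_vec_bounded h.continuous_B
  obtain ⟨MT, hMT⟩ := torus_bounded_of_continuous (g := fun x => transport f x v)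
    (continuous_finsetSum _ fun i _ =>
      continuous_const.mul (continuous_torusPartial (h.smooth_x_one v) i))
  refine ⟨ν * (3 * VelocityProfile.fluxDecay D 0) + MT + 3 * (2 * MB * D 1), fun x => ?_⟩
  have hD : 0 ≤ D 1 := (h.profile x).decay.nonneg 1
  have h1 : |landauOperator coulombKernel (f x) v| ≤ 3 * VelocityProfile.fluxDecay D 0 := by
    simpa using (h.profile x).rapidDecay_landauOperator 0 v
  have h2 : |∑ i, lorentz 0 (B x) i v * velPartial i (f x) v| ≤ 3 * (2 * MB * D 1) := by
    have h3 := RapidDecay.sum (fun i => ((h.profile x).decay_partial i).mul_poly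
      (polyGrowth_lorentz 0 (B x) i)) 0 v
    simp only [pow_zero, one_mul, norm_zero, zero_add] at h3
    refine h3.trans ?_
    have := hMB x
    gcongr
  have h4 : ∑ i, E x i * velPartial i (f x) v = ν * landauOperator coulombKernel (f x) v -
      transport f x v - ∑ i, lorentz 0 (B x) i v * velPartial i (f x) v := by
    rw [← h.vlasov x v]
    simp only [lorentz, PiLp.add_apply, zero_add, add_mul,
      Finset.sum_add_distrib]
    ring
  have h5 : |ν * landauOperator coulombKernel (f x) v| ≤
      ν * (3 * VelocityProfile.fluxDecay D 0) := by
    rw [abs_mul, abs_of_pos h.ν_pos]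
    exact mul_le_mul_of_nonneg_left h1 h.ν_pos.le
  rw [h4]
  calc _ ≤ |ν * landauOperator coulombKernel (f x) v - transport f x v| + _ := abs_sub _ _
    _ ≤ |ν * landauOperator coulombKernel (f x) v| + |transport f x v| + _ := by
        gcongr
        exact abs_sub _ _
    _ ≤ _ := add_le_add (add_le_add h5 (hMT x)) h2

lemma transport_eq (h : IsSteadyState ν ρ_ion D C K f E B) (x : Torus3) (v : Vec3) :
    transport f x v = ν * landauOperator coulombKernel (f x) v -
      ∑ i, lorentz (E x) (B x) i v * velPartial i (f x) v := by
  rw [← h.vlasov x v]; ring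

/-- The velocity decay of the transport term is read off from the other terms of the equation; the
bounds on `E`, `B` and `log f(x, 0)` make it uniform in `x`. -/
lemma exists_rapidDecay_log_mul_transport (h : IsSteadyState ν ρ_ion D C K f E B) :
    ∃ D', ∀ x, RapidDecay D' fun v => Real.log (f x v) * transport f x v := by
  obtain ⟨ME, hME⟩ := h.bounded_E
  obtain ⟨MB, hMB⟩ := torus_vec_bounded h.continuous_B
  obtain ⟨ML, hML⟩ := torus_bounded_of_continuous (g := fun x => Real.log (f x 0))
    ((h.continuous_x 0).log fun x => ((h.profile x).pos 0).ne')
  let DT : ℕ → ℝ := fun N => ν * (3 * VelocityProfile.fluxDecay D N) +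
    3 * ((ME + 2 * MB) * D (N + 1))
  have hT : ∀ x, RapidDecay DT (transport f x) := by
    intro x
    have h1 : RapidDecay _ (fun v => ν * landauOperator coulombKernel (f x) v) :=
      (h.profile x).rapidDecay_landauOperator.mul_poly
        (p := fun _ => ν) (C := ν) (m := 0) fun v => by simp [abs_of_pos h.ν_pos]
    have h2 := RapidDecay.sum (fun i => ((h.profile x).decay_partial i).mul_poly
      (polyGrowth_lorentz (E x) (B x) i))
    have h3 := h1.sub h2
    simp only [← h.transport_eq] at h3
    refine h3.mono fun N => ?_
    have hD := (h.profile x).decay.nonneg (N + 1)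
    have := hME x
    have := hMB x
    simp only [DT, add_zero]
    gcongr
  refine ⟨fun N => (ML + 3 * C) * DT (N + (K + 1)), fun x => ?_⟩
  refine ((hT x).mul_poly (h.profile x).polyGrowth_log).mono fun N => ?_
  have := (hT x).nonneg (N + (K + 1))
  have := hML x
  gcongr

lemma integral_log_mul_transport_eq (h : IsSteadyState ν ρ_ion D C K f E B) (x : Torus3) :
    ∫ v, Real.log (f x v) * transport f x v =
      ν * ∫ v, Real.log (f x v) * landauOperator coulombKernel (f x) v := by
  have he : ∀ v, Real.log (f x v) * transport f x v =
      ν * (Real.log (f x v) * landauOperator coulombKernel (f x) v) -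
        Real.log (f x v) * ∑ i, lorentz (E x) (B x) i v * velPartial i (f x) v := by
    intro v
    rw [h.transport_eq]
    ring
  have hi : Integrable fun v =>
      Real.log (f x v) * ∑ i, lorentz (E x) (B x) i v * velPartial i (f x) v := by
    refine (integrable_finsetSum Finset.univ fun i _ =>
      (h.profile x).integrable_log_mul_force (E x) (B x) i).congr (Eventually.of_forall fun v => ?_)
    simp only [Finset.mul_sum]
    exact Finset.sum_congr rfl fun i _ => by ring
  simp only [he]
  rw [integral_sub ((h.profile x).integrable_landauOperator_mul_log.const_mul ν) hi,
    integral_const_mul, (h.profile x).integral_log_mul_force, sub_zero]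

/-- Zero dissipation gives this for almost every `x`; scores are continuous in `x`, so it extends to
every `x`. -/
theorem score_collinear (h : IsSteadyState ν ρ_ion D C K f E B) (x : Torus3) (i j : Fin 3)
    (v w : Vec3) :
    (v i - w i) * (velScore (f x) j v - velScore (f x) j w) =
      (v j - w j) * (velScore (f x) i v - velScore (f x) i w) := by
  obtain ⟨D', hD'⟩ := h.exists_rapidDecay_log_mul_transport
  have hae := ae_integral_log_mul_transport_eq_zero (fun x => (h.profile x).pos)
    h.smooth_x_one (fun x => (h.profile x).contDiff.continuous) hD' fun x => by
      rw [h.integral_log_mul_transport_eq]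
      exact mul_nonpos_of_nonneg_of_nonpos h.ν_pos.le
        (h.profile x).integral_log_mul_landauOperator_nonpos
  have hs : ∀ i v, Continuous fun x => velScore (f x) i v := fun i v =>
    (continuous_velPartial_param (fun x => (h.profile x).toVelocityProfile) h.continuous_x i v).div
      (h.continuous_x v) fun x => ((h.profile x).pos v).ne'
  have hl : Continuous fun x => (v i - w i) * (velScore (f x) j v - velScore (f x) j w) :=
    continuous_const.mul ((hs j v).sub (hs j w))
  have hr : Continuous fun x => (v j - w j) * (velScore (f x) i v - velScore (f x) i w) :=
    continuous_const.mul ((hs i v).sub (hs i w))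
  refine congrFun ((hl.ae_eq_iff_eq (volume : Measure Torus3) hr).1 ?_) x
  filter_upwards [hae] with x hx
  rw [h.integral_log_mul_transport_eq] at hx
  exact (h.profile x).collinear_of_dissipation_eq_zero
    ((mul_eq_zero.1 hx).resolve_left h.ν_pos.ne') i j v w

end IsSteadyState

/-- The Landau operator vanishes on profiles with affine score. -/
lemma PositiveProfile.landauOperator_eq_zero {D : ℕ → ℝ} {C : ℝ} {K : ℕ} {g : Vec3 → ℝ}
    (hg : PositiveProfile D C K g) {a : Fin 3 → ℝ} {b : ℝ}
    (hs : ∀ i v, velScore g i v = a i + b * v i) (v : Vec3) :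
    landauOperator coulombKernel g v = 0 := by
  have hA : ∀ (z : Vec3) (i : Fin 3), ∑ j, landauMatrix coulombKernel z i j * z j = 0 := by
    intro z i
    have hz : ‖z‖ ^ 2 = z 0 ^ 2 + z 1 ^ 2 + z 2 ^ 2 := by
      rw [EuclideanSpace.norm_sq_eq]
      simp [Fin.sum_univ_three]
    simp only [landauMatrix, Matrix.of_apply, Fin.sum_univ_three, hz]
    fin_cases i <;> simp <;> ring
  have hJ : ∀ i, landauFlux coulombKernel g i = fun _ => 0 := by
    intro i
    ext v
    have : ∀ w, ∑ j, landauMatrix coulombKernel (v - w) i j *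
        (g w * velPartial j g v - g v * velPartial j g w) = 0 := by
      intro w
      have h1 := hA (v - w) i
      -- For an affine score, `g(w) ∇g(v) - g(v) ∇g(w) = b g(v) g(w) (v - w)`, which lies in the
      -- kernel of `A(v - w)`.
      calc _ = (b * g v * g w) *
            ∑ j, landauMatrix coulombKernel (v - w) i j * (v - w) j := by
            rw [Finset.mul_sum]
            refine Finset.sum_congr rfl fun j _ => ?_
            rw [hg.partial_eq, hg.partial_eq, hs, hs, PiLp.sub_apply]
            ring
        _ = 0 := by rw [h1, mul_zero]
    simp [landauFlux, this]
  simp [landauOperator, hJ, velPartial]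

/-! ### Rigidity of locally Maxwellian steady states -/

/-- The logarithm of `f` is `c + a · v + b |v|² / 2` with coefficients of class `C²` in space and
`b < 0`. -/
structure IsLocalMaxwellian (f : Torus3 → Vec3 → ℝ) (a : Fin 3 → Torus3 → ℝ)
    (b c : Torus3 → ℝ) : Prop where
  smooth_a : ∀ i, ContDiff ℝ 2 (periodicLift (a i))
  smooth_b : ContDiff ℝ 2 (periodicLift b)
  smooth_c : ContDiff ℝ 2 (periodicLift c)
  neg : ∀ x, b x < 0
  score_eq : ∀ x i v, velScore (f x) i v = a i x + b x * v i
  log_eq : ∀ x v, Real.log (f x v) = c x + ∑ i, a i x * v i + b x / 2 * ∑ i, v i ^ 2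

lemma cubic_coeff_eq_zero {α β γ δ : ℝ} (h : ∀ t : ℝ, α + β * t + γ * t ^ 2 + δ * t ^ 3 = 0) :
    α = 0 ∧ β = 0 ∧ γ = 0 ∧ δ = 0 := by
  have h0 := h 0
  have h1 := h 1
  have h2 := h (-1)
  have h3 := h 2
  norm_num at h0 h1 h2 h3
  refine ⟨by linarith, by linarith, by linarith, by linarith⟩

/-- A periodic vector field whose derivative is skew-symmetric is constant. -/
lemma torus_const_of_killing {a : Fin 3 → Torus3 → ℝ}
    (ha : ∀ i, Differentiable ℝ (periodicLift (a i)))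
    (h : ∀ x (d : Fin 3 → ℝ), ∑ i, ∑ j, d i * d j * torusPartial i (a j) x = 0)
    (k : Fin 3) (x y : Torus3) : a k x = a k y := by
  obtain ⟨x, rfl⟩ := isOpenQuotientMap_torusProj.surjective x
  obtain ⟨y, rfl⟩ := isOpenQuotientMap_torusProj.surjective y
  -- Along the segment from `y` in direction `d`, the derivative of `d · a` is the symmetric
  -- gradient evaluated on `(d, d)`, hence zero.
  have key : ∀ d : Fin 3 → ℝ,
      ∑ j, d j * a j (torusProj (y + d)) = ∑ j, d j * a j (torusProj y) := by
    intro d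
    have hline : ∀ t : ℝ, HasDerivAt (fun t : ℝ => y + t • d) d t := fun t => by
      simpa using ((hasDerivAt_id t).smul_const d).const_add y
    have hd : ∀ t : ℝ, HasDerivAt (fun t : ℝ => ∑ j, d j * periodicLift (a j) (y + t • d)) 0 t := by
      intro t
      have h1 : HasDerivAt (fun t : ℝ => ∑ j, d j * periodicLift (a j) (y + t • d))
          (∑ j, d j * fderiv ℝ (periodicLift (a j)) (y + t • d) d) t :=
        HasDerivAt.fun_sum fun j _ =>
          ((ha j _).hasFDerivAt.comp_hasDerivAt t (hline t)).const_mul (d j)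
      refine h1.congr_deriv ?_
      rw [← h (torusProj (y + t • d)) d, Finset.sum_comm]
      refine Finset.sum_congr rfl fun j _ => ?_
      rw [clm_apply_eq_sum, Finset.mul_sum]
      refine Finset.sum_congr rfl fun i _ => ?_
      rw [torusPartial_torusProj (ha j)]
      ring
    have hc := is_const_of_deriv_eq_zero (fun t => (hd t).differentiableAt)
      (fun t => (hd t).deriv) 1 0
    simpa [periodicLift_apply] using hc
  have h1 := key (x - y)
  -- Lengthening the chord by a lattice vector keeps its endpoint on the torus; the difference of
  -- the two identities isolates `a k`.
  let n : Fin 3 → ℤ := Pi.single k 1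
  have h2 := key (x - y + fun i => (n i : ℝ))
  rw [← add_assoc, torusProj_add_int] at h2
  rw [add_sub_cancel] at h1 h2
  simp only [Pi.add_apply, add_mul, Finset.sum_add_distrib, h1] at h2
  have h3 := add_left_cancel h2
  simpa [n, Pi.single_apply] using h3

lemma integral_velPartial_eq_zero {D : ℕ → ℝ} {g : Vec3 → ℝ} (hg : VelocityProfile D g)
    (i : Fin 3) : ∫ v, velPartial i g v = 0 := by
  have hi : Integrable (velPartial i g) :=
    (hg.decay_partial i).integrable (measurable_velPartial i g).aestronglyMeasurable
  have hi' : Integrable fun v => fderiv ℝ g v (EuclideanSpace.single i 1) := hi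
  have h := integral_mul_fderiv_eq_neg_fderiv_mul_of_integrable (μ := (volume : Measure Vec3))
    (f := fun _ => (1 : ℝ)) (g := g) (v := EuclideanSpace.single i 1) (by simp)
    (by simpa using hi')
    (by simpa using hg.decay.integrable hg.contDiff.continuous.aestronglyMeasurable)
    (fun v _ => differentiableAt_const _) (fun v _ => hg.differentiable v)
  simpa [velPartial] using h

lemma polyGrowth_coord (i : Fin 3) : PolyGrowth 1 1 (fun v => v i) := by
  intro v
  have := abs_coord_le v i
  simp only [pow_one, one_mul]
  linarith

/-! ### Coefficients of the local Maxwellian -/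

namespace IsSteadyState

variable {ν ρ_ion : ℝ} {D : ℕ → ℝ} {C : ℝ} {K : ℕ} {f : Torus3 → Vec3 → ℝ}
  {E B : Torus3 → Vec3} {a : Fin 3 → Torus3 → ℝ} {b c : Torus3 → ℝ}

theorem exists_isLocalMaxwellian (h : IsSteadyState ν ρ_ion D C K f E B) :
    ∃ a b c, IsLocalMaxwellian f a b c := by
  choose b hb using fun x => exists_affine_of_collinear (h.score_collinear x)
  let a : Fin 3 → Torus3 → ℝ := fun i x => velScore (f x) i 0
  let c : Torus3 → ℝ := fun x => Real.log (f x 0)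
  have hlog : ∀ x v, Real.log (f x v) = c x + ∑ i, a i x * v i + b x / 2 * ∑ i, v i ^ 2 :=
    fun x v => (h.profile x).log_eq_of_score_affine (hb x) v
  have hsm : ∀ v, ContDiff ℝ 2 (periodicLift fun x => Real.log (f x v)) := fun v =>
    (h.smooth_x v).log fun y => ((h.profile _).pos v).ne'
  have hlog1 : ∀ x i, Real.log (f x (EuclideanSpace.single i 1)) = c x + a i x + b x / 2 := by
    intro x i
    rw [hlog]
    simp
  have hlog2 : ∀ x i, Real.log (f x (-EuclideanSpace.single i 1)) = c x - a i x + b x / 2 := by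
    intro x i
    rw [hlog]
    simp
    ring
  -- The slope `b` was obtained by choice. Writing the coefficients through values of `log f` at `0`
  -- and `±eᵢ` gives their regularity in `x`.
  have ha : ∀ i, a i = fun x => (Real.log (f x (EuclideanSpace.single i 1)) -
      Real.log (f x (-EuclideanSpace.single i 1))) / 2 := by
    intro i
    ext x
    rw [hlog1, hlog2]
    ring
  have hb' : b = fun x => Real.log (f x (EuclideanSpace.single 0 1)) +
      Real.log (f x (-EuclideanSpace.single 0 1)) - 2 * Real.log (f x 0) := by
    ext x
    rw [hlog1, hlog2]
    simp only [c]
    ring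
  refine ⟨a, b, c, ⟨fun i => ?_, ?_, hsm 0, fun x => (h.profile x).neg_of_score_affine (hb x),
    fun x i v => hb x i v, hlog⟩⟩
  · rw [ha i]
    exact ((hsm _).sub (hsm _)).div_const 2
  · rw [hb']
    exact ((hsm _).add (hsm _)).sub (contDiff_const.mul (hsm 0))

lemma torusPartial_f (h : IsSteadyState ν ρ_ion D C K f E B) (hM : IsLocalMaxwellian f a b c)
    (i : Fin 3) (x : Torus3) (v : Vec3) :
    torusPartial i (fun y => f y v) x = f x v * (torusPartial i c x +
      ∑ j, torusPartial i (a j) x * v j + torusPartial i b x / 2 * ∑ j, v j ^ 2) := by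
  have hc := hasDerivAt_torus_zero (hM.smooth_c.differentiable (by simp)) i x
  have hb := hasDerivAt_torus_zero (hM.smooth_b.differentiable (by simp)) i x
  have ha := fun j => hasDerivAt_torus_zero ((hM.smooth_a j).differentiable (by simp)) i x
  have hsum := (hc.fun_add (HasDerivAt.fun_sum fun j (_ : j ∈ Finset.univ) =>
    (ha j).mul_const (v j))).fun_add ((hb.div_const 2).mul_const (∑ j, v j ^ 2))
  have hexp := hsum.exp
  simp only [← hM.log_eq, Real.exp_log ((h.profile _).pos v), AddCircle.coe_zero,
    Pi.single_zero, add_zero] at hexp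
  exact torusPartial_eq_of_hasDerivAt hexp

/-- The collision term is zero and `f` factors out, leaving a cubic polynomial in `v`. Replacing `v`
by `t v` separates its homogeneous parts. -/
lemma vlasov_polynomial (h : IsSteadyState ν ρ_ion D C K f E B)
    (hM : IsLocalMaxwellian f a b c) (x : Torus3) (v : Vec3) :
    ∑ i, E x i * a i x = 0 ∧
    ∑ i, v i * torusPartial i c x + ∑ i, cross v (B x) i * a i x +
      b x * ∑ i, E x i * v i = 0 ∧
    ∑ i, ∑ j, v i * v j * torusPartial i (a j) x = 0 ∧
    (∑ j, v j ^ 2) * ∑ i, v i * torusPartial i b x = 0 := by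
  have hP : ∀ v : Vec3, (∑ i, v i * (torusPartial i c x + ∑ j, torusPartial i (a j) x * v j +
      torusPartial i b x / 2 * ∑ j, v j ^ 2)) +
      ∑ i, lorentz (E x) (B x) i v * (a i x + b x * v i) = 0 := by
    intro v
    have h1 := h.vlasov x v
    rw [(h.profile x).landauOperator_eq_zero (hM.score_eq x), mul_zero] at h1
    simp only [transport, h.torusPartial_f hM, (h.profile x).partial_eq, hM.score_eq] at h1
    have h2 := ((h.profile x).pos v).ne'
    refine (mul_eq_zero.1 ?_).resolve_left h2
    rw [← h1, mul_add, Finset.mul_sum, Finset.mul_sum]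
    congr 1 <;> exact Finset.sum_congr rfl fun i _ => by ring
  have hsplit : ∀ v : Vec3, ∑ i, lorentz (E x) (B x) i v * (a i x + b x * v i) =
      ∑ i, E x i * a i x + ∑ i, cross v (B x) i * a i x + b x * ∑ i, E x i * v i := by
    intro v
    rw [← sum_lorentz_mul_self (E x) (B x) v, Finset.mul_sum, ← Finset.sum_add_distrib,
      ← Finset.sum_add_distrib]
    refine Finset.sum_congr rfl fun i _ => ?_
    simp only [lorentz, PiLp.add_apply]
    ring
  have hcub := cubic_coeff_eq_zero (α := ∑ i, E x i * a i x)
    (β := ∑ i, v i * torusPartial i c x + ∑ i, cross v (B x) i * a i x +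
      b x * ∑ i, E x i * v i) (γ := ∑ i, ∑ j, v i * v j * torusPartial i (a j) x)
    (δ := 1 / 2 * ((∑ j, v j ^ 2) * ∑ i, v i * torusPartial i b x)) fun t => by
      rw [← hP (t • v), hsplit]
      simp only [Fin.sum_univ_three, PiLp.smul_apply, smul_eq_mul, cross_apply_zero,
        cross_apply_one, cross_apply_two]
      ring
  exact ⟨hcub.1, hcub.2.1, hcub.2.2.1, by linarith [hcub.2.2.2]⟩

lemma b_const (h : IsSteadyState ν ρ_ion D C K f E B) (hM : IsLocalMaxwellian f a b c)
    (x y : Torus3) : b x = b y := by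
  refine torus_const_of_partial_eq_zero (hM.smooth_b.differentiable (by simp))
    (fun i x => ?_) x y
  have h1 := (h.vlasov_polynomial hM x (EuclideanSpace.single i 1)).2.2.2
  simpa [Pi.single_apply] using h1

lemma a_const (h : IsSteadyState ν ρ_ion D C K f E B) (hM : IsLocalMaxwellian f a b c)
    (i : Fin 3) (x y : Torus3) : a i x = a i y :=
  torus_const_of_killing (fun j => (hM.smooth_a j).differentiable (by simp))
    (fun x d => (h.vlasov_polynomial hM x (WithLp.toLp 2 d)).2.2.1) i x y

/-! ### Moments, zero current and the magnetic field -/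

lemma integrable_f (h : IsSteadyState ν ρ_ion D C K f E B) (x : Torus3) : Integrable (f x) :=
  (h.profile x).decay.integrable (h.profile x).contDiff.continuous.aestronglyMeasurable

/-- Integrate `∂ᵢ f = (aᵢ + b vᵢ) f` over velocities; the left side has zero integral. -/
lemma momentum_eq (h : IsSteadyState ν ρ_ion D C K f E B) (hM : IsLocalMaxwellian f a b c)
    (i : Fin 3) (x : Torus3) :
    a i x * (∫ v, f x v) + b x * ∫ v, v i * f x v = 0 := by
  have hi : Integrable fun v => v i * f x v :=
    ((h.profile x).decay.mul_poly (polyGrowth_coord i)).integrable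
      ((differentiable_coord i).continuous.mul
        (h.profile x).contDiff.continuous).aestronglyMeasurable
  rw [← integral_velPartial_eq_zero (h.profile x).toVelocityProfile i, ← integral_const_mul,
    ← integral_const_mul, ← integral_add ((h.integrable_f x).const_mul _) (hi.const_mul _)]
  refine integral_congr_ae (Eventually.of_forall fun v => ?_)
  simp only [(h.profile x).partial_eq, hM.score_eq]
  ring

lemma density_pos (h : IsSteadyState ν ρ_ion D C K f E B) (x : Torus3) : 0 < ∫ v, f x v := by
  rw [integral_pos_iff_support_of_nonneg (fun v => ((h.profile x).pos v).le) (h.integrable_f x)]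
  have : Function.support (f x) = Set.univ :=
    Set.eq_univ_of_forall fun v => ((h.profile x).pos v).ne'
  rw [this]
  exact Measure.measure_univ_pos.2 (NeZero.ne _)

lemma continuous_and_integral_torusCurl (hB : ∀ i, ContDiff ℝ 1 (periodicLift fun x => B x i))
    (i : Fin 3) : Continuous (fun x => torusCurl B x i) ∧ ∫ x, torusCurl B x i = 0 := by
  have hc : ∀ j k : Fin 3, Continuous fun x => torusPartial j (fun y => B y k) x := fun j k =>
    continuous_torusPartial (hB k) j
  have hi : ∀ j k l m : Fin 3, ∫ x, (torusPartial j (fun y => B y k) x -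
      torusPartial l (fun y => B y m) x) = 0 := fun j k l m => by
    rw [integral_sub (torus_integrable_of_continuous (hc j k))
      (torus_integrable_of_continuous (hc l m)), integral_torusPartial (hB k),
      integral_torusPartial (hB m), sub_zero]
  fin_cases i
  · exact ⟨(hc 1 2).sub (hc 2 1), hi 1 2 2 1⟩
  · exact ⟨(hc 2 0).sub (hc 0 2), hi 2 0 0 2⟩
  · exact ⟨(hc 0 1).sub (hc 1 0), hi 0 1 1 0⟩

/-- By Ampère's law, `aᵢ²` times the density is a constant multiple of a curl component. It is
nonnegative with mean zero, so it vanishes, and the density is positive. -/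
lemma a_eq_zero (h : IsSteadyState ν ρ_ion D C K f E B) (hM : IsLocalMaxwellian f a b c)
    (i : Fin 3) (x : Torus3) : a i x = 0 := by
  obtain ⟨hcont, hint⟩ := continuous_and_integral_torusCurl
    (fun i => (h.smooth_B i).of_le (by norm_num)) i
  have heq : ∀ y, a i y ^ 2 * ∫ v, f y v = (-(b x * a i x)) * torusCurl B y i := by
    intro y
    have h1 := h.momentum_eq hM i y
    rw [← h.ampere] at h1
    rw [h.b_const hM x y, h.a_const hM i x y]
    linear_combination a i y * h1
  have h0 := torus_eq_zero_of_nonneg (h := fun y => (-(b x * a i x)) * torusCurl B y i)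
    (continuous_const.mul hcont)
    (fun y => by rw [← heq]; exact mul_nonneg (sq_nonneg _) (h.density_pos y).le)
    (by rw [integral_const_mul, hint, mul_zero]) x
  simp only [← heq] at h0
  exact pow_eq_zero_iff two_ne_zero |>.1 ((mul_eq_zero.1 h0).resolve_right (h.density_pos x).ne')

/-- The linear part of the Vlasov polynomial once `a = 0`. It exhibits `E` as a gradient and gives
it the differentiability that Gauss's law needs. -/
lemma torusPartial_c (h : IsSteadyState ν ρ_ion D C K f E B) (hM : IsLocalMaxwellian f a b c)
    (i : Fin 3) (x : Torus3) : torusPartial i c x = -b x * E x i := by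
  have h1 := (h.vlasov_polynomial hM x (EuclideanSpace.single i 1)).2.1
  simp only [h.a_eq_zero hM, mul_zero, Finset.sum_const_zero, add_zero] at h1
  simp at h1
  linarith

lemma curl_eq_zero (h : IsSteadyState ν ρ_ion D C K f E B) (hM : IsLocalMaxwellian f a b c)
    (i : Fin 3) (x : Torus3) : torusCurl B x i = 0 := by
  have h1 := h.momentum_eq hM i x
  rw [h.a_eq_zero hM, zero_mul, zero_add, ← h.ampere] at h1
  exact (mul_eq_zero.1 h1).resolve_left (hM.neg x).ne

/-- A curl-free field has `∂ⱼ Bᵢ = ∂ᵢ Bⱼ`, so `Δ Bᵢ = ∂ᵢ (∇ · B) = 0` and each component is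
harmonic. -/
lemma B_const (h : IsSteadyState ν ρ_ion D C K f E B) (hM : IsLocalMaxwellian f a b c)
    (x y : Torus3) : B x = B y := by
  have h0 := fun x => h.curl_eq_zero hM 0 x
  have h1 := fun x => h.curl_eq_zero hM 1 x
  have h2 := fun x => h.curl_eq_zero hM 2 x
  simp [torusCurl] at h0 h1 h2
  have hsym : ∀ i j : Fin 3, torusPartial i (fun y => B y j) = torusPartial j fun y => B y i := by
    intro i j
    ext x
    have := h0 x
    have := h1 x
    have := h2 x
    fin_cases i <;> fin_cases j <;> simp only [Fin.zero_eta, Fin.mk_one, Fin.reduceFinMk] <;>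
      linarith
  have hd : ∀ j k : Fin 3, Differentiable ℝ (periodicLift (torusPartial j fun y => B y k)) :=
    fun j k => (contDiff_torusPartial (m := 1) (h.smooth_B k) (by norm_num) j).differentiable
      (by simp)
  ext i
  refine torus_const_of_laplacian_eq_zero (h.smooth_B i) (fun x => ?_) x y
  calc ∑ j, torusPartial j (torusPartial j fun y => B y i) x
      = ∑ j, torusPartial i (torusPartial j fun y => B y j) x :=
        Finset.sum_congr rfl fun j _ => by
          rw [hsym j i, torusPartial_comm (h.smooth_B j)]
    _ = torusPartial i (fun x => torusDiv B x) x :=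
        (torusPartial_eq_of_hasDerivAt (HasDerivAt.fun_sum fun j _ =>
          hasDerivAt_torus_zero (hd j j) i x)).symm
    _ = 0 := by
        simp only [h.divB]
        exact deriv_const _ _

/-! ### Density, the Poisson–Boltzmann equation and the conclusion -/

lemma f_eq (h : IsSteadyState ν ρ_ion D C K f E B) (hM : IsLocalMaxwellian f a b c)
    (x : Torus3) (v : Vec3) : f x v = Real.exp (c x) * Real.exp (-(-b x / 2) * ‖v‖ ^ 2) := by
  rw [← Real.exp_log ((h.profile x).pos v), hM.log_eq, ← Real.exp_add,
    EuclideanSpace.norm_sq_eq]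
  simp [h.a_eq_zero hM]
  ring

lemma density_eq (h : IsSteadyState ν ρ_ion D C K f E B) (hM : IsLocalMaxwellian f a b c)
    (x : Torus3) :
    ∫ v, f x v = Real.exp (c x) * (2 * Real.pi * (-1 / b x)) ^ (3 / 2 : ℝ) := by
  have hb := hM.neg x
  simp only [h.f_eq hM]
  -- The exponent in `f_eq` is written `-(-b x / 2)` so that the Gaussian formula applies with the
  -- positive coefficient `-b x / 2`.
  rw [integral_const_mul, GaussianFourier.integral_rexp_neg_mul_sq_norm (by linarith)]
  congr 2
  · field_simp
  · simp

/-- Gauss's law for `E = -∇c / b`. As the density is a constant multiple of `exp c`, this is a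
Poisson–Boltzmann equation for `c`. -/
lemma poisson (h : IsSteadyState ν ρ_ion D C K f E B) (hM : IsLocalMaxwellian f a b c)
    (x : Torus3) :
    ∑ i, torusPartial i (torusPartial i c) x = -b x * ((∫ v, f x v) - ρ_ion) := by
  have hd : ∀ i, Differentiable ℝ (periodicLift (torusPartial i c)) := fun i =>
    (contDiff_torusPartial (m := 1) hM.smooth_c (by norm_num) i).differentiable (by simp)
  have hb := (hM.neg x).ne
  have hE : ∀ i, (fun y => E y i) = fun y => (-1 / b x) * torusPartial i c y := by
    intro i
    ext y
    rw [h.torusPartial_c hM, ← h.b_const hM x y]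
    field_simp
  rw [← h.gauss, torusDiv, Finset.mul_sum]
  refine Finset.sum_congr rfl fun i _ => ?_
  rw [hE, torusPartial_const_mul (hd i)]
  field_simp

/-- Maximum principle: since `-b > 0`, the density is at most `ρ_ion` where `c` is maximal and at
least `ρ_ion` where `c` is minimal. It increases with `c`, so it is pinned everywhere. -/
lemma density_eq_ion (h : IsSteadyState ν ρ_ion D C K f E B) (hM : IsLocalMaxwellian f a b c)
    (x : Torus3) : ∫ v, f x v = ρ_ion := by
  have hcont : Continuous c := continuous_of_periodicLift hM.smooth_c.continuous
  obtain ⟨x₁, -, hx₁⟩ := isCompact_univ.exists_isMaxOn Set.univ_nonempty hcont.continuousOn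
  obtain ⟨x₀, -, hx₀⟩ := isCompact_univ.exists_isMinOn Set.univ_nonempty hcont.continuousOn
  have hmax : ∀ y, c y ≤ c x₁ := fun y => hx₁ (Set.mem_univ y)
  have hmin : ∀ y, c x₀ ≤ c y := fun y => hx₀ (Set.mem_univ y)
  have hmono : ∀ y z, c y ≤ c z → ∫ v, f y v ≤ ∫ v, f z v := by
    intro y z hyz
    have hb := hM.neg z
    rw [h.density_eq hM, h.density_eq hM, h.b_const hM y z]
    have : 0 ≤ -1 / b z := div_nonneg_of_nonpos (by norm_num) hb.le
    gcongr
  have h1 : ∫ v, f x₁ v ≤ ρ_ion := by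
    have hb := hM.neg x₁
    have hp := h.poisson hM x₁
    have : ∑ i, torusPartial i (torusPartial i c) x₁ ≤ 0 :=
      Finset.sum_nonpos fun i _ => torusPartial_torusPartial_nonpos hM.smooth_c hmax i
    by_contra hcon
    push Not at hcon
    nlinarith [mul_pos (neg_pos.2 hb) (sub_pos.2 hcon)]
  have h2 : ρ_ion ≤ ∫ v, f x₀ v := by
    have hb := hM.neg x₀
    have hp := h.poisson hM x₀
    have hd : ∀ i, Differentiable ℝ (periodicLift (torusPartial i c)) := fun i =>
      (contDiff_torusPartial (m := 1) hM.smooth_c (by norm_num) i).differentiable (by simp)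
    have hneg : ContDiff ℝ 2 (periodicLift fun y => (-1) * c y) :=
      contDiff_const.mul hM.smooth_c
    have : 0 ≤ ∑ i, torusPartial i (torusPartial i c) x₀ := by
      refine Finset.sum_nonneg fun i _ => ?_
      have h3 := torusPartial_torusPartial_nonpos hneg (x := x₀)
        (fun y => by linarith [hmin y]) i
      have h4 : torusPartial i (fun y => (-1) * c y) = fun y => (-1) * torusPartial i c y :=
        funext fun y => torusPartial_const_mul (hM.smooth_c.differentiable (by simp)) _ i y
      rw [h4, torusPartial_const_mul (hd i)] at h3
      linarith
    by_contra hcon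
    push Not at hcon
    nlinarith [mul_pos (neg_pos.2 hb) (sub_pos.2 hcon)]
  exact le_antisymm ((hmono x x₁ (hmax x)).trans h1) (h2.trans (hmono x₀ x (hmin x)))

theorem eq_equilibrium (h : IsSteadyState ν ρ_ion D C K f E B) :
    ∃ (T : ℝ) (B₀ : Vec3), 0 < T ∧
      (∀ x v, f x v = equilibriumMaxwellian ρ_ion T v) ∧
      (∀ x, E x = 0) ∧
      (∀ x, B x = B₀) := by
  obtain ⟨a, b, c, hM⟩ := h.exists_isLocalMaxwellian
  have hb := hM.neg 0
  -- The temperature is `T = -1 / b`, from matching `b |v|² / 2` with `-|v|² / (2T)`.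
  have hT : 0 < -1 / b 0 := div_pos_of_neg_of_neg (by norm_num) hb
  have hZ : 0 < (2 * Real.pi * (-1 / b 0)) ^ (3 / 2 : ℝ) := by positivity
  have hexp : ∀ x, Real.exp (c x) = ρ_ion / (2 * Real.pi * (-1 / b 0)) ^ (3 / 2 : ℝ) := by
    intro x
    rw [eq_div_iff hZ.ne', ← h.density_eq_ion hM x, h.density_eq hM, h.b_const hM x 0]
  refine ⟨-1 / b 0, B 0, hT, fun x v => ?_, fun x => ?_, fun x => h.B_const hM x 0⟩
  · rw [h.f_eq hM, hexp, equilibriumMaxwellian, h.b_const hM x 0]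
    congr 2
    field_simp
  · ext i
    -- Constant density fixes `exp c`, hence `c`, and then `-b E = ∇c = 0`.
    have hc : c = fun _ => c 0 := funext fun y =>
      Real.exp_injective ((hexp y).trans (hexp 0).symm)
    have h1 := h.torusPartial_c hM i x
    have h2 : torusPartial i c x = 0 := by
      rw [hc]
      exact deriv_const _ _
    rw [h2] at h1
    simpa using (mul_eq_zero.1 h1.symm).resolve_left (neg_ne_zero.2 (hM.neg x).ne)

end IsSteadyState

end

theorem theorem1
    (f : Torus3 → Vec3 → ℝ) (E B : Torus3 → Vec3) (ν ρ_ion : ℝ)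
    (hν : 0 < ν) (hρ_ion : 0 < ρ_ion)
    (hf_pos : ∀ x v, 0 < f x v)
    (hf_smooth_v : ∀ x, ContDiff ℝ 3 (f x))
    (hf_smooth_x : ∀ v, ContDiff ℝ 2 (periodicLift (fun x => f x v)))
    (hB_smooth : ∀ i, ContDiff ℝ 2 (periodicLift (fun x => B x i)))
    (hSchwartz : UniformSchwartzDecay f)
    (hScore : ∃ (C : ℝ) (K : ℕ), ∀ x v i,
      |velPartial i (f x) v| ≤ C * (1 + ‖v‖) ^ K * f x v)
    (hVlasov : ∀ x v,
      (∑ i, v i * torusPartial i (fun y => f y v) x) +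
        (∑ i, (E x + cross v (B x)) i * velPartial i (f x) v) =
      ν * landauOperator coulombKernel (f x) v)
    (hAmpere : ∀ x i, torusCurl B x i = ∫ v, v i * f x v)
    (hGauss : ∀ x, torusDiv E x = (∫ v, f x v) - ρ_ion)
    (hDivB : ∀ x, torusDiv B x = 0) :
    ∃ (T : ℝ) (B₀ : Vec3), 0 < T ∧
      (∀ x v, f x v = equilibriumMaxwellian ρ_ion T v) ∧
      (∀ x, E x = 0) ∧
      (∀ x, B x = B₀) := by
  obtain ⟨D, hD⟩ := hSchwartz.exists_velocityProfile hf_smooth_v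
  obtain ⟨C, K, hCK⟩ := hScore
  have h : IsSteadyState ν ρ_ion D C K f E B :=
    { ν_pos := hν
      profile := fun x => ⟨hD x, hf_pos x, hCK x⟩
      smooth_x := hf_smooth_x
      smooth_B := hB_smooth
      vlasov := hVlasov
      ampere := hAmpere
      gauss := hGauss
      divB := hDivB }
  exact h.eq_equilibrium
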